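/- Let $n\ge 2$, let $s\ge 2$, $a\in(0,1)$, $q\in(\frac n2,n]$, and let $(M^n,g,k)$ be a $C^{s,a}_{-q}$-asymptotically Anti-de Sitter (AdS) initial data set: $(M,g)$ is a complete connected Riemannian manifold without boundary, $k$ is a symmetric two-tensor, the complement of a compact set is a finite disjoint union of ends, each of them identified by a diffeomorphism with the complement of a ball in hyperbolic space $(\mathbb H^n,b)$, on each end $g-b$ lies in the weighted Hölder space $C^{s,a}_{-q}$ and $k$ in $C^{s-1,a}_{-q}$, and $\mu r,|J|_g r\in L^1$ on the ends, where $r$ is the area radius, $\mu=\frac12(R+(\operatorname{tr}_gk)^2-|k|_g^2+n(n-1))$ and $J=\operatorname{div}(k-(\operatorname{tr}_gk)g)$. Fix an end and the ball model $b=\xi^{-2}\delta$, $\xi=\frac{1-|z|^2}2$, of $\mathbb H^n$. For a function $N$ and a vector field $X$ let $$\mathcal H(N,X)=\lim_{R\to\infty}\frac1{2(n-1)\omega_{n-1}}\int_{S_R}\big(\mathbb U^i(N)+\mathbb V^i(X)\big)\nu_i\,dA,$$ $$\mathbb U^i(N)=2\big(Ng^{i[k}g^{j]l}\mathring\nabla_jg_{kl}+\mathring\nabla^{[i}N\,g^{j]k}(g_{jk}-b_{jk})\big),\qquad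 \mathbb V^i(X)=2\big(k^i{}_j-(\operatorname{tr}_gk)\delta^i_j\big)X^j,$$ where $S_R$ is the centred sphere $\{r=R\}$, $\nu$ and $dA$ are its outward unit normal and area element with respect to $b$, $\mathring\nabla$ is the Levi-Civita connection of $b$, and $\omega_{n-1}$ is the area of the unit sphere $S^{n-1}$. Let the energy $\mathcal E$, linear momentum $\mathcal P$, center of mass $\mathcal C$ and angular momentum $\mathcal A$ of the end be defined by the following limits (it being understood that these limits exist): $$\mathcal E=\mathcal H\Big(\tfrac{2(1+|z|^2)}{1-|z|^2},0\Big),\quad \mathcal P_i=\mathcal H\Big(\tfrac{-4z_i}{1-|z|^2},0\Big),\quad \mathcal C_i=\mathcal H\big(0,(1+|z|^2)\partial_i-2z_iz_k\partial_k\big),\quad \mathcal A_{ij}=\mathcal H(0,z_i\partial_j-z_j\partial_i).$$ Let $\mathcal S$ be a spinor module of Euclidean $\mathbb R^n$ (a unitary complex Clifford module of dimension $2^{\lfloor n/2\rfloor}$, $e_i^2=-1$), $\overline{\mathcal S}=\mathcal S\oplus\mathcal S$ with $e_i(\psi_1,\psi_2)=(e_i\psi_1,-e_i\psi_2)$, $e_0(\psi_1,\psi_2)=(\psi_2,\psi_1)$,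 and put $N(\psi)=|\psi|^2$, $X(\psi)=\langle e_ie_0\psi,\psi\rangle e_i$, $Y(\psi)=\langle \mathbf i e_i\psi,\psi\rangle e_i$. A constant spinor $u\in\overline{\mathcal S}$ defines the imaginary Killing spinor $\psi_u=\xi^{-1/2}(1-\mathbf i\,z)u$ on $\mathbb H^n$ ($z$ acting by Clifford multiplication, the spinor bundle being trivialized by the $b$-orthonormal frame $\xi\partial_i$). It is called null if $|X(\psi_u)|=N(\psi_u)$ everywhere, type I if $|Y(\psi_u)|=N(\psi_u)$ everywhere, and mass-minimizing if it minimizes $\mathcal H(N(\psi_u),X(\psi_u))$ among all $\psi_v$ with $|v|=|u|$. Theorem. In each of the following cases there exists $u\neq0$ such that $\psi_u$ is a type I null mass-minimizing imaginary Killing spinor: 1. $\mathcal A=0$; 2. $\mathcal A$ is simple, i.e. $\mathcal A=a\,e\wedge f$ with $a\in\mathbb R$ and $e,f$ orthonormal, and $\mathcal C=0$; 3. $\mathcal A$ is simple and $\mathcal P=0$. -/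

import Mathlib

open scoped Manifold ContDiff Topology Bundle

noncomputable section

namespace AdS

/-- Euclidean space, the model space of an `n`-manifold. Its open unit ball is also the underlying
set of the ball model of hyperbolic space. -/
abbrev E (n : ℕ) := EuclideanSpace ℝ (Fin n)

/-- The `i`-th standard basis vector. -/
def stdVec {n : ℕ} (i : Fin n) : E n := EuclideanSpace.single i 1

/-- The `i`-th partial derivative of a real function. -/
def partialD {n : ℕ} (i : Fin n) (f : E n → ℝ) (z : E n) : ℝ := fderiv ℝ f z (stdVec i)

/-! ### Hyperbolic space in the ball model -/

/-- The conformal factor `ξ = (1 - |z|²) / 2` of the ball model. -/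
def xi {n : ℕ} (z : E n) : ℝ := (1 - ‖z‖ ^ 2) / 2

/-- Components of the hyperbolic metric `b = ξ⁻² δ` in the ball coordinates. -/
def hypMetric {n : ℕ} (z : E n) : Matrix (Fin n) (Fin n) ℝ := (xi z ^ 2)⁻¹ • 1

/-- The area radius `r = 2|z| / (1 - |z|²)` at a point of the ball. -/
def areaRadius {n : ℕ} (z : E n) : ℝ := 2 * ‖z‖ / (1 - ‖z‖ ^ 2)

/-- The Euclidean radius of the coordinate sphere of area radius `R` (inverse of `areaRadius`). -/
def ballRadius (R : ℝ) : ℝ := R / (1 + √(1 + R ^ 2))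

/-- The complement in hyperbolic space of the closed centred ball of area radius `R₀`. -/
def exterior (n : ℕ) (R₀ : ℝ) : Set (E n) := {z | ‖z‖ < 1 ∧ R₀ < areaRadius z}

/-- The hyperbolic distance of two points of the ball. -/
def hypDist {n : ℕ} (z w : E n) : ℝ :=
  2 * Real.arsinh (‖z - w‖ / √((1 - ‖z‖ ^ 2) * (1 - ‖w‖ ^ 2)))

/-- Derivative of a function along the `b`-orthonormal frame vector `ξ ∂_i`. -/
def frameD {n : ℕ} (i : Fin n) (f : E n → ℝ) (z : E n) : ℝ := xi z * partialD i f z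

/-- Iterated derivative along vectors of the `b`-orthonormal frame `ξ ∂_1, …, ξ ∂_n`. -/
def iterFrameD {n : ℕ} (I : List (Fin n)) (f : E n → ℝ) : E n → ℝ := I.foldr frameD f

/-- The weighted Hölder space `C^{s,a}_{-q}` on the exterior region: the functions that are `C^s`
there, whose derivatives up to order `s` in the `b`-orthonormal frame are `O(r^{-q})`, and whose
derivatives of order `s` have `a`-Hölder seminorm `O(r^{-q})` on hyperbolic unit balls. (The
connection coefficients of the frame `ξ ∂_i` and all their frame derivatives are bounded, so that
bounding the frame derivatives of the components of a tensor up to order `s` is the same as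
bounding its covariant derivatives up to order `s`.) -/
def InWeightedHolder {n : ℕ} (R₀ : ℝ) (s : ℕ) (a q : ℝ) (f : E n → ℝ) : Prop :=
  ContDiffOn ℝ s f (exterior n R₀) ∧
  (∃ C : ℝ, ∀ I : List (Fin n), I.length ≤ s → ∀ z ∈ exterior n R₀,
    areaRadius z ^ q * |iterFrameD I f z| ≤ C) ∧
  (∃ C : ℝ, ∀ I : List (Fin n), I.length = s → ∀ z ∈ exterior n R₀,
    ∀ x ∈ exterior n R₀, ∀ y ∈ exterior n R₀, hypDist z x < 1 → hypDist z y < 1 →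
      areaRadius z ^ q * |iterFrameD I f x - iterFrameD I f y| ≤ C * hypDist x y ^ a)

/-! ### Tensor calculus in coordinates

A field of bilinear forms on a coordinate domain is given by its matrix of components. -/

/-- Christoffel symbols `Γ^m_{ij}` of the metric `G`. -/
def christoffel {n : ℕ} (G : E n → Matrix (Fin n) (Fin n) ℝ) (z : E n) (m i j : Fin n) : ℝ :=
  (1 / 2) * ∑ l, (G z)⁻¹ m l *
    (partialD i (fun w => G w j l) z + partialD j (fun w => G w i l) z
      - partialD l (fun w => G w i j) z)

/-- The covariant derivative `∇_m T_{ij}` for the Levi-Civita connection of the metric `G`. -/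
def covD {n : ℕ} (G T : E n → Matrix (Fin n) (Fin n) ℝ) (z : E n) (m i j : Fin n) : ℝ :=
  partialD m (fun w => T w i j) z
    - ∑ l, (christoffel G z l m i * T z l j + christoffel G z l m j * T z i l)

/-- The Ricci tensor of the metric `G`. -/
def ricci {n : ℕ} (G : E n → Matrix (Fin n) (Fin n) ℝ) (z : E n) (i j : Fin n) : ℝ :=
  ∑ m, (partialD m (fun w => christoffel G w m i j) z
      - partialD i (fun w => christoffel G w m m j) z
      + ∑ l, (christoffel G z m m l * christoffel G z l i j
        - christoffel G z m i l * christoffel G z l m j))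

/-- The scalar curvature of the metric `G`. -/
def scalarCurv {n : ℕ} (G : E n → Matrix (Fin n) (Fin n) ℝ) (z : E n) : ℝ :=
  ∑ i, ∑ j, (G z)⁻¹ i j * ricci G z i j

/-- The trace of `K` with respect to the metric `G`. -/
def traceK {n : ℕ} (G K : E n → Matrix (Fin n) (Fin n) ℝ) (z : E n) : ℝ :=
  ∑ i, ∑ j, (G z)⁻¹ i j * K z i j

/-- The squared norm of `K` with respect to the metric `G`. -/
def normSqK {n : ℕ} (G K : E n → Matrix (Fin n) (Fin n) ℝ) (z : E n) : ℝ :=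
  ∑ i, ∑ j, ∑ l, ∑ m, (G z)⁻¹ i l * (G z)⁻¹ j m * K z i j * K z l m

/-- The energy density `μ = (R + (tr k)² - |k|² + n(n-1)) / 2`. -/
def energyDensity {n : ℕ} (G K : E n → Matrix (Fin n) (Fin n) ℝ) (z : E n) : ℝ :=
  (1 / 2) * (scalarCurv G z + traceK G K z ^ 2 - normSqK G K z + (n : ℝ) * ((n : ℝ) - 1))

/-- The momentum density `J = div (k - (tr k) g)`. -/
def momentumDensity {n : ℕ} (G K : E n → Matrix (Fin n) (Fin n) ℝ) (z : E n) (i : Fin n) : ℝ :=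
  ∑ j, ∑ l, (G z)⁻¹ j l * covD G (fun w => K w - traceK G K w • G w) z l j i

/-- The norm `|J|_g`. -/
def momentumNorm {n : ℕ} (G K : E n → Matrix (Fin n) (Fin n) ℝ) (z : E n) : ℝ :=
  √(∑ i, ∑ j, (G z)⁻¹ i j * momentumDensity G K z i * momentumDensity G K z j)

/-! ### Asymptotically AdS initial data sets -/

/-- A `C^{s,a}_{-q}`-asymptotically AdS initial data set structure on the complete connected
Riemannian manifold `M` without boundary (whose metric is `g`).

The integrability of `μ r̄` and `|J| r̄` is required on each end. On the compact rest of `M` it is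
automatic, since `g` is `C²` and `k` is `C¹`. -/
structure AsymptoticallyAdS (n s : ℕ) (a q : ℝ) (M : Type*) [MetricSpace M]
    [ChartedSpace (E n) M] [IsManifold 𝓘(ℝ, E n) ∞ M]
    [Bundle.RiemannianBundle (fun x : M => TangentSpace 𝓘(ℝ, E n) x)]
    [IsContMDiffRiemannianBundle 𝓘(ℝ, E n) 2 (E n) (fun x : M => TangentSpace 𝓘(ℝ, E n) x)]
    [IsRiemannianManifold 𝓘(ℝ, E n) M] [CompleteSpace M] [ConnectedSpace M] where
  /-- The symmetric two-tensor `k`. -/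
  k : ∀ x : M, TangentSpace 𝓘(ℝ, E n) x →L[ℝ] TangentSpace 𝓘(ℝ, E n) x →L[ℝ] ℝ
  k_symm : ∀ x v w, k x v w = k x w v
  k_contMDiff : ContMDiff 𝓘(ℝ, E n) (𝓘(ℝ, E n).prod 𝓘(ℝ, E n →L[ℝ] E n →L[ℝ] ℝ)) 1
    (fun x : M => Bundle.TotalSpace.mk' (E n →L[ℝ] E n →L[ℝ] ℝ)
      (E := fun x : M => TangentSpace 𝓘(ℝ, E n) x →L[ℝ] TangentSpace 𝓘(ℝ, E n) x →L[ℝ] ℝ)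
      x (k x))
  /-- The compact core. -/
  core : Set M
  isCompact_core : IsCompact core
  numEnds : ℕ
  /-- The charts `φ^ℓ` of the ends, diffeomorphisms onto complements of balls in `ℍⁿ`. -/
  chart : Fin numEnds → OpenPartialHomeomorph M (E n)
  R₀ : Fin numEnds → ℝ
  R₀_pos : ∀ l, 0 < R₀ l
  chart_target : ∀ l, (chart l).target = exterior n (R₀ l)
  chart_smooth : ∀ l, ContMDiffOn 𝓘(ℝ, E n) 𝓘(ℝ, E n) ∞ (chart l) (chart l).source
  chart_symm_smooth :
    ∀ l, ContMDiffOn 𝓘(ℝ, E n) 𝓘(ℝ, E n) ∞ (chart l).symm (chart l).target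
  ends_disjoint : ∀ l m, l ≠ m → Disjoint (chart l).source (chart m).source
  ends_cover : ⋃ l, (chart l).source = coreᶜ
  /-- The components of `g` on the ends, in the ball coordinates. -/
  gEnd : Fin numEnds → E n → Matrix (Fin n) (Fin n) ℝ
  gEnd_eq : ∀ l, ∀ z ∈ exterior n (R₀ l), ∀ i j, gEnd l z i j =
    inner ℝ (mfderiv 𝓘(ℝ, E n) 𝓘(ℝ, E n) (chart l).symm z (stdVec i))
      (mfderiv 𝓘(ℝ, E n) 𝓘(ℝ, E n) (chart l).symm z (stdVec j))
  /-- The components of `k` on the ends, in the ball coordinates. -/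
  kEnd : Fin numEnds → E n → Matrix (Fin n) (Fin n) ℝ
  kEnd_eq : ∀ l, ∀ z ∈ exterior n (R₀ l), ∀ i j, kEnd l z i j =
    k ((chart l).symm z) (mfderiv 𝓘(ℝ, E n) 𝓘(ℝ, E n) (chart l).symm z (stdVec i))
      (mfderiv 𝓘(ℝ, E n) 𝓘(ℝ, E n) (chart l).symm z (stdVec j))
  /-- Decay of the components of `g - b` in the `b`-orthonormal frame `ξ ∂_i`. -/
  metric_decay : ∀ l i j,
    InWeightedHolder (R₀ l) s a q (fun z => xi z ^ 2 * (gEnd l z i j - hypMetric z i j))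
  /-- Decay of the components of `k` in the `b`-orthonormal frame `ξ ∂_i`. -/
  k_decay : ∀ l i j,
    InWeightedHolder (R₀ l) (s - 1) a q (fun z => xi z ^ 2 * kEnd l z i j)
  energy_integrable : ∀ l, MeasureTheory.IntegrableOn
    (fun z => energyDensity (gEnd l) (kEnd l) z * areaRadius z * √(gEnd l z).det)
    (exterior n (R₀ l))
  momentum_integrable : ∀ l, MeasureTheory.IntegrableOn
    (fun z => momentumNorm (gEnd l) (kEnd l) z * areaRadius z * √(gEnd l z).det)
    (exterior n (R₀ l))

/-! ### The mass functional -/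

/-- `𝕌^i(N) = 2 (N g^{i[k} g^{j]l} ∇̊_j g_{kl} + ∇̊^{[i} N g^{j]k} (g_{jk} - b_{jk}))`, where the
brackets denote antisymmetrization with the factor `1/2`, so that
`2 g^{i[k} g^{j]l} = g^{ik} g^{jl} - g^{ij} g^{kl}`, and `∇̊^i N = ξ² ∂_i N` is the `b`-gradient. -/
def fluxU {n : ℕ} (G : E n → Matrix (Fin n) (Fin n) ℝ) (N : E n → ℝ) (z : E n) (i : Fin n) : ℝ :=
  N z * (∑ j, ∑ k, ∑ l, ((G z)⁻¹ i k * (G z)⁻¹ j l - (G z)⁻¹ i j * (G z)⁻¹ k l)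
      * covD hypMetric G z j k l)
    + ∑ j, ∑ k, (xi z ^ 2 * partialD i N z * (G z)⁻¹ j k
      - xi z ^ 2 * partialD j N z * (G z)⁻¹ i k) * (G z j k - hypMetric z j k)

/-- `𝕍^i(X) = 2 (k^i_j - (tr_g k) δ^i_j) X^j`, for a vector field `X` with components `X^j` in the
ball coordinates. -/
def fluxV {n : ℕ} (G K : E n → Matrix (Fin n) (Fin n) ℝ) (X : E n → Fin n → ℝ) (z : E n)
    (i : Fin n) : ℝ :=
  2 * ∑ j, ((∑ l, (G z)⁻¹ i l * K z l j) - traceK G K z * (if i = j then 1 else 0)) * X z j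

/-- The flux `(2 (n-1) ω_{n-1})⁻¹ ∫_{S_R} (𝕌^i(N) + 𝕍^i(X)) ν_i dA` through the sphere of area
radius `R`, written as an integral over the unit sphere: at `z = ϱ σ` with `|σ| = 1` the conormal
of the sphere is `ν_i = ξ⁻¹ σ_i` and its area element is `dA = ξ^{-(n-1)} ϱ^{n-1} dσ`. -/
def flux {n : ℕ} (G K : E n → Matrix (Fin n) (Fin n) ℝ) (N : E n → ℝ) (X : E n → Fin n → ℝ)
    (R : ℝ) : ℝ :=
  (2 * ((n : ℝ) - 1) *
      ((MeasureTheory.volume : MeasureTheory.Measure (E n)).toSphere Set.univ).toReal)⁻¹ *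
    ∫ σ : Metric.sphere (0 : E n) 1,
      (∑ i, (fluxU G N (ballRadius R • (σ : E n)) i + fluxV G K X (ballRadius R • (σ : E n)) i)
          * ((xi (ballRadius R • (σ : E n)))⁻¹ * (σ : E n) i))
        * ((xi (ballRadius R • (σ : E n)))⁻¹ ^ (n - 1) * ballRadius R ^ (n - 1))
      ∂((MeasureTheory.volume : MeasureTheory.Measure (E n)).toSphere)

/-- `HasMass G K N X m` means `ℋ(N, X) = m`: the fluxes through `S_R` converge to `m` as
`R → ∞`. -/
def HasMass {n : ℕ} (G K : E n → Matrix (Fin n) (Fin n) ℝ) (N : E n → ℝ) (X : E n → Fin n → ℝ)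
    (m : ℝ) : Prop :=
  Filter.Tendsto (flux G K N X) Filter.atTop (𝓝 m)

/-- The end with metric `G` and second fundamental form `K` has the energy `𝓔`, the linear
momentum `𝓟`, the center of mass `𝓒` and the angular momentum `𝓐`:
`𝓔 = ℋ(2(1+|z|²)/(1-|z|²), 0)`, `𝓟_i = ℋ(-4z_i/(1-|z|²), 0)`,
`𝓒_i = ℋ(0, (1+|z|²) ∂_i - 2 z_i z_k ∂_k)` and `𝓐_ij = ℋ(0, z_i ∂_j - z_j ∂_i)`. -/
structure HasCharges {n : ℕ} (G K : E n → Matrix (Fin n) (Fin n) ℝ) (energy : ℝ)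
    (linMom center : E n) (angMom : Matrix (Fin n) (Fin n) ℝ) : Prop where
  hasEnergy : HasMass G K (fun z => 2 / (1 - ‖z‖ ^ 2) * (1 + ‖z‖ ^ 2)) (fun _ _ => 0) energy
  hasLinMom : ∀ i, HasMass G K (fun z => -2 * (2 / (1 - ‖z‖ ^ 2) * z i)) (fun _ _ => 0) (linMom i)
  hasCenter : ∀ i, HasMass G K (fun _ => 0)
    (fun z k => (1 + ‖z‖ ^ 2) * (if k = i then 1 else 0) - 2 * z i * z k) (center i)
  hasAngMom : ∀ i j, HasMass G K (fun _ => 0)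
    (fun z k => z i * (if k = j then 1 else 0) - z j * (if k = i then 1 else 0)) (angMom i j)

/-- A two-form is simple if it is `a e ∧ f` for a real number `a` and orthonormal `e`, `f`. -/
def IsSimple {n : ℕ} (A : Matrix (Fin n) (Fin n) ℝ) : Prop :=
  ∃ (a : ℝ) (e f : E n), ‖e‖ = 1 ∧ ‖f‖ = 1 ∧ inner ℝ e f = (0 : ℝ) ∧
    ∀ i j, A i j = a * (e i * f j - e j * f i)

/-! ### Spinors -/

/-- `S` is a complex spinor module of Euclidean `n`-space: a unitary module over the Clifford
algebra (with `e_i² = -1`) of the dimension `2^⌊n/2⌋` of the irreducible ones. -/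
structure SpinorModule (n : ℕ) (S : Type*) [NormedAddCommGroup S] [InnerProductSpace ℂ S] where
  /-- Clifford multiplication. -/
  cliff : E n →ₗ[ℝ] (S →ₗ[ℂ] S)
  cliff_sq : ∀ v ψ, cliff v (cliff v ψ) = -(((‖v‖ ^ 2 : ℝ) : ℂ) • ψ)
  cliff_skew : ∀ v ψ χ, inner ℂ (cliff v ψ) χ = -inner ℂ ψ (cliff v χ)
  finrank_eq : Module.finrank ℂ S = 2 ^ (n / 2)

/-- The spacetime spinors `S ⊕ S`. -/
abbrev DoubleSpinor (S : Type*) := WithLp 2 (S × S)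

section Spinors

variable {n : ℕ} {S : Type*} [NormedAddCommGroup S] [InnerProductSpace ℂ S]

/-- Clifford multiplication by a spatial vector: `v (ψ₁, ψ₂) = (v ψ₁, -v ψ₂)`. -/
def spaceMul (c : SpinorModule n S) (v : E n) (ψ : DoubleSpinor S) : DoubleSpinor S :=
  WithLp.toLp 2 (c.cliff v ψ.fst, -c.cliff v ψ.snd)

/-- Clifford multiplication by the timelike unit vector: `e₀ (ψ₁, ψ₂) = (ψ₂, ψ₁)`. -/
def timeMul (ψ : DoubleSpinor S) : DoubleSpinor S := WithLp.toLp 2 (ψ.snd, ψ.fst)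

/-- `N(ψ) = |ψ|²`. -/
def currentN (ψ : DoubleSpinor S) : ℝ := ‖ψ‖ ^ 2

/-- `X(ψ) = ⟨e_i e_0 ψ, ψ⟩ e_i`. -/
def currentX (c : SpinorModule n S) (ψ : DoubleSpinor S) : E n :=
  WithLp.toLp 2 fun i => (inner ℂ ψ (spaceMul c (stdVec i) (timeMul ψ))).re

/-- `Y(ψ) = ⟨𝐢 e_i ψ, ψ⟩ e_i`. -/
def currentY (c : SpinorModule n S) (ψ : DoubleSpinor S) : E n :=
  WithLp.toLp 2 fun i => (inner ℂ ψ (Complex.I • spaceMul c (stdVec i) ψ)).re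

/-- A spinor is null if `|X| = N`. -/
def IsNull (c : SpinorModule n S) (ψ : DoubleSpinor S) : Prop := ‖currentX c ψ‖ = currentN ψ

/-- A spinor is of type I if `N = |Y|`. -/
def IsTypeI (c : SpinorModule n S) (ψ : DoubleSpinor S) : Prop := currentN ψ = ‖currentY c ψ‖

/-- The imaginary Killing spinor `ψ^∞ = ξ^{-1/2} (1 - 𝐢 ϱ e_ϱ) u` on `ℍⁿ` corresponding to the
constant spinor `u` (`ϱ e_ϱ` being the position vector `z`), in the trivialization of the spinor
bundle by the `b`-orthonormal frame `ξ ∂_i`. -/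
def killingSpinor (c : SpinorModule n S) (u : DoubleSpinor S) (z : E n) : DoubleSpinor S :=
  ((xi z ^ (-(1 / 2) : ℝ) : ℝ) : ℂ) • (u - Complex.I • spaceMul c z u)

/-- The imaginary Killing equation `∇̊_v ψ = -(𝐢/2) v ψ` on the ball model, for the tangent
vectors `Σ v_i ξ ∂_i`. By the conformal transformation formula, the spin
connection of `b = ξ⁻² δ` is
`∇̊_{ξ v} ψ = ξ (∂_v ψ + (1/2) v (grad log ξ) ψ + (1/2) (∂_v log ξ) ψ)`, where
`grad log ξ = -ξ⁻¹ z`. -/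
def IsImaginaryKilling (c : SpinorModule n S) (ψ : E n → DoubleSpinor S) : Prop :=
  ∀ z : E n, ‖z‖ < 1 → ∀ v : E n, ∃ ψ' : DoubleSpinor S,
    HasDerivAt (fun t : ℝ => ψ (z + t • v)) ψ' 0 ∧
    ((xi z : ℝ) : ℂ) • ψ' - (1 / 2 : ℂ) • spaceMul c v (spaceMul c z (ψ z))
      - ((1 / 2 * inner ℝ v z : ℝ) : ℂ) • ψ z = -(Complex.I / 2) • spaceMul c v (ψ z)

theorem spaceMul_add_smul (c : SpinorModule n S) (z v : E n) (t : ℝ) (ψ : DoubleSpinor S) :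
    spaceMul c (z + t • v) ψ = spaceMul c z ψ + ((t : ℝ) : ℂ) • spaceMul c v ψ := by
  refine WithLp.ofLp_injective 2 (Prod.ext ?_ ?_)
  · simp [spaceMul]
  · simp [spaceMul]
    abel

theorem spaceMul_sub_smul (c : SpinorModule n S) (v : E n) (a : ℂ) (ψ χ : DoubleSpinor S) :
    spaceMul c v (ψ - a • χ) = spaceMul c v ψ - a • spaceMul c v χ := by
  refine WithLp.ofLp_injective 2 (Prod.ext ?_ ?_)
  · simp [spaceMul]
  · simp [spaceMul]
    abel

theorem spaceMul_smul (c : SpinorModule n S) (v : E n) (a : ℂ) (ψ : DoubleSpinor S) :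
    spaceMul c v (a • ψ) = a • spaceMul c v ψ := by
  refine WithLp.ofLp_injective 2 (Prod.ext ?_ ?_) <;> simp [spaceMul]

theorem spaceMul_sq (c : SpinorModule n S) (v : E n) (ψ : DoubleSpinor S) :
    spaceMul c v (spaceMul c v ψ) = -(((‖v‖ ^ 2 : ℝ) : ℂ) • ψ) := by
  refine WithLp.ofLp_injective 2 (Prod.ext ?_ ?_) <;> simp [spaceMul, c.cliff_sq]

/-- The spinors `ψ^∞` are imaginary Killing spinors. -/
theorem isImaginaryKilling_killingSpinor (c : SpinorModule n S) (u : DoubleSpinor S) :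
    IsImaginaryKilling c (killingSpinor c u) := by
  intro z hz v
  have hxi : 0 < xi z := by
    have : ‖z‖ ^ 2 < 1 := by nlinarith [norm_nonneg z]
    unfold xi; linarith
  have h1 : HasDerivAt (fun t : ℝ => xi (z + t • v)) (-inner ℝ v z) 0 := by
    have : (fun t : ℝ => xi (z + t • v)) =
        fun t : ℝ => (1 - (‖z‖ ^ 2 + 2 * (t * inner ℝ v z) + t ^ 2 * ‖v‖ ^ 2)) / 2 := by
      funext t
      rw [xi, norm_add_sq_real, norm_smul, mul_pow, real_inner_smul_right, real_inner_comm,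
        Real.norm_eq_abs, sq_abs]
    rw [this]
    have e1 := ((hasDerivAt_id (0 : ℝ)).mul_const (inner ℝ v z)).const_mul 2
    have e2 := ((hasDerivAt_id (0 : ℝ)).pow 2).mul_const (‖v‖ ^ 2)
    have e3 := ((((e1.const_add (‖z‖ ^ 2)).add e2).const_sub 1).div_const 2)
    refine e3.congr_deriv ?_
    simp
    ring
  have h2 : HasDerivAt (fun t : ℝ => xi (z + t • v) ^ (-(1 / 2) : ℝ))
      (1 / 2 * inner ℝ v z * (xi z)⁻¹ * xi z ^ (-(1 / 2) : ℝ)) 0 := by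
    refine (h1.rpow_const (p := -(1 / 2)) (Or.inl (by simpa using hxi.ne'))).congr_deriv ?_
    simp only [zero_smul, add_zero]
    rw [Real.rpow_sub_one hxi.ne']
    ring
  have h3 : HasDerivAt (fun t : ℝ => u - Complex.I • spaceMul c (z + t • v) u)
      (-(Complex.I • spaceMul c v u)) 0 := by
    have : (fun t : ℝ => u - Complex.I • spaceMul c (z + t • v) u) =
        fun t : ℝ => (u - Complex.I • spaceMul c z u) - ((t : ℝ) : ℂ) •
          (Complex.I • spaceMul c v u) := by
      funext t
      rw [spaceMul_add_smul, smul_add, smul_comm ((t : ℝ) : ℂ)]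
      abel
    rw [this]
    have e1 : HasDerivAt (fun t : ℝ => ((t : ℝ) : ℂ)) 1 0 := Complex.ofRealCLM.hasDerivAt
    have e2 := (e1.smul_const (Complex.I • spaceMul c v u)).const_sub
      (u - Complex.I • spaceMul c z u)
    simpa using e2
  refine ⟨_, (h2.ofReal_comp.smul h3), ?_⟩
  have hz2 : ((‖z‖ ^ 2 : ℝ) : ℂ) = 1 - 2 * ((xi z : ℝ) : ℂ) := by
    have : ‖z‖ ^ 2 = 1 - 2 * xi z := by unfold xi; ring
    rw [this]; push_cast; ring
  have hne : ((xi z : ℝ) : ℂ) ≠ 0 := by exact_mod_cast hxi.ne'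
  simp only [killingSpinor, zero_smul, add_zero, spaceMul_smul, spaceMul_sub_smul, spaceMul_sq, hz2]
  generalize xi z ^ (-(1 / 2) : ℝ) = f
  generalize spaceMul c v (spaceMul c z u) = p
  have hneg : spaceMul c v (-((1 - 2 * ((xi z : ℝ) : ℂ)) • u)) =
      -((1 - 2 * ((xi z : ℝ) : ℂ)) • spaceMul c v u) := by
    rw [← neg_smul, spaceMul_smul, neg_smul]
  rw [hneg]
  generalize spaceMul c v u = w
  generalize spaceMul c z u = y
  push_cast
  match_scalars <;> field_simp <;> ring_nf <;> simp

/-- `ℋ(N(ψ^∞), X(ψ^∞)) = m` for the imaginary Killing spinor `ψ^∞` corresponding to `u`. The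
components of `X(ψ^∞)` in the frame `ξ ∂_i` are multiplied by `ξ` to get those in the ball
coordinates. -/
def HasSpinorMass (c : SpinorModule n S) (G K : E n → Matrix (Fin n) (Fin n) ℝ)
    (u : DoubleSpinor S) (m : ℝ) : Prop :=
  HasMass G K (fun z => currentN (killingSpinor c u z))
    (fun z i => xi z * currentX c (killingSpinor c u z) i) m

/-- The imaginary Killing spinor corresponding to `u` minimizes `ℋ` among all those that correspond
to a constant spinor `v` with `|v| = |u|`. (In particular `ℋ` is defined for all of them.) -/
def IsMassMinimizing (c : SpinorModule n S) (G K : E n → Matrix (Fin n) (Fin n) ℝ)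
    (u : DoubleSpinor S) : Prop :=
  ∃ m, HasSpinorMass c G K u m ∧
    ∀ v : DoubleSpinor S, ‖v‖ = ‖u‖ → ∃ m', HasSpinorMass c G K v m' ∧ m ≤ m'

end Spinors

end AdS

end

/-!
Let `α v = 𝐢 v` and `β v = v e₀`, so that `Y` and `X` are the expectations of `α` and `β`. Since the
currents of `ψ_u` are quadratic in `u`, additivity of the flux integrals shows that the mass of
`ψ_u` is the expectation in the state `u` of
`𝓔 + α(𝓟) + β(𝓒) - ∑ 𝓐_kl α(e_k) β(e_l)`.

If `α y u = u` and `β x u = u` for orthonormal `y`, `x`, then `ψ_u` is null of type I: on `u`, the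
operator `1 - α z` agrees with `α (y - z)`, and Clifford multiplication by `y - z` intertwines `α`
and, up to sign, `β` with their reflections in the line through `y - z`, so that `ψ_u` is fixed by
some `α y'` and `β x'` with unit vectors `y'`, `x'`. Such `u ≠ 0` exist for each orthonormal pair.

It remains to choose the pair so that `u` belongs to the lowest eigenvalue of the operator. If
`𝓐 = 0`, a simultaneous rotation of `(α, β)` and `(𝓟, 𝓒)` makes `𝓟` and `𝓒` orthogonal, and the
eigenvalue is `-(‖𝓟‖ + ‖𝓒‖)` for the rotated vectors. If `𝓐` is simple and `𝓒 = 0`, rotate `e`, `f`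
in their plane and change their signs so that the operator becomes `𝓔 - (α w + b α(e) β(f))` with
`w = -𝓟`, `⟪w, f⟫ = 0`, `⟪w, e⟫ ≥ 0` and `b ≥ 0`; the square of the bracket is
`‖w‖² + b² + 2 b ⟪w, e⟫ β(f)`, so its norm is `‖w + b e‖`, attained on `β(f) u = u`. The case
`𝓟 = 0` follows by exchanging `α` and `β`.
-/

namespace AdS

section Expectation

variable {V : Type*} [NormedAddCommGroup V] [InnerProductSpace ℂ V]

/-- The expectation `Re ⟨T ψ, ψ⟩` of an operator `T` in the state `ψ`, as a linear function
of `T`. -/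
noncomputable def expectation (ψ : V) : Module.End ℂ V →ₗ[ℝ] ℝ where
  toFun T := (inner ℂ ψ (T ψ)).re
  map_add' T T' := by simp
  map_smul' r T := by simp

theorem expectation_apply (ψ : V) (T : Module.End ℂ V) :
    expectation ψ T = (inner ℂ ψ (T ψ)).re := rfl

theorem expectation_of_fixed {ψ : V} {T : Module.End ℂ V} (h : T ψ = ψ) :
    expectation ψ T = ‖ψ‖ ^ 2 := by
  rw [expectation_apply, h, inner_self_eq_norm_sq_to_K]
  norm_cast

theorem expectation_one (ψ : V) : expectation ψ 1 = ‖ψ‖ ^ 2 :=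
  expectation_of_fixed rfl

theorem expectation_apply_symmetric {A : Module.End ℂ V} (hA : A.IsSymmetric) (T : Module.End ℂ V)
    (ψ : V) : expectation (A ψ) T = expectation ψ (A * T * A) :=
  congrArg Complex.re (hA ψ (T (A ψ)))

theorem abs_expectation_le (ψ : V) (T : Module.End ℂ V) : |expectation ψ T| ≤ ‖ψ‖ * ‖T ψ‖ :=
  (Complex.abs_re_le_norm _).trans (norm_inner_le_norm _ _)

theorem norm_apply_sq {A : Module.End ℂ V} (hA : A.IsSymmetric) (ψ : V) :
    ‖A ψ‖ ^ 2 = expectation ψ (A * A) := by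
  rw [← expectation_one, expectation_apply_symmetric hA, mul_one]

theorem isMinOn_expectation {H : Module.End ℂ V} {m : ℝ} {u : V} (hH : ∀ ψ, ‖H ψ‖ ≤ m * ‖ψ‖)
    (hu : H u = -(m • u)) : IsMinOn (fun v => expectation v H) (Metric.sphere 0 ‖u‖) u := by
  intro v hv
  have hv' : ‖v‖ = ‖u‖ := by simpa using hv
  have at_u : expectation u H = -(m * ‖u‖ ^ 2) := by
    have : expectation u (-H) = m * ‖u‖ ^ 2 := by
      rw [← expectation_one u, ← smul_eq_mul, ← map_smul, expectation_apply, expectation_apply]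
      simp [hu]
    rw [← this, map_neg, neg_neg]
  have at_v : |expectation v H| ≤ m * ‖u‖ ^ 2 :=
    calc |expectation v H| ≤ ‖v‖ * (m * ‖v‖) :=
          (abs_expectation_le v H).trans (mul_le_mul_of_nonneg_left (hH v) (norm_nonneg v))
      _ = m * ‖u‖ ^ 2 := by rw [hv']; ring
  exact at_u.trans_le (neg_le_of_abs_le at_v)

end Expectation

section Planes

variable {F : Type*} [NormedAddCommGroup F] [InnerProductSpace ℝ F]

theorem norm_eq_of_inner_le {v w : F} {r : ℝ} (hv : ‖v‖ = 1) (hvw : inner ℝ v w = r)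
    (hle : ∀ x, inner ℝ x w ≤ ‖x‖ * r) : ‖w‖ = r := by
  rcases eq_or_ne w 0 with rfl | hw
  · simpa using hvw
  · have lower : r ≤ ‖w‖ := by
      simpa only [hvw, hv, one_mul] using real_inner_le_norm v w
    have upper : ‖w‖ * ‖w‖ ≤ ‖w‖ * r := by
      simpa only [real_inner_self_eq_norm_mul_norm] using hle w
    exact (le_of_mul_le_mul_left upper (norm_pos_iff.mpr hw)).antisymm lower

/-- A pair of orthonormal vectors. -/
structure OrthonormalPair (e f : F) : Prop where
  norm_left : ‖e‖ = 1
  norm_right : ‖f‖ = 1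
  inner_eq_zero : inner ℝ e f = 0

theorem OrthonormalPair.symm {e f : F} (h : OrthonormalPair e f) : OrthonormalPair f e :=
  ⟨h.norm_right, h.norm_left, by rw [real_inner_comm, h.inner_eq_zero]⟩

theorem OrthonormalPair.rotate {e f : F} (h : OrthonormalPair e f) {c s : ℝ}
    (hcs : c ^ 2 + s ^ 2 = 1) : OrthonormalPair (c • e + s • f) (-s • e + c • f) := by
  have norm_eq : ∀ a b : ℝ, a ^ 2 + b ^ 2 = 1 → ‖a • e + b • f‖ = 1 := by
    intro a b hab
    rw [← sq_eq_sq₀ (norm_nonneg _) zero_le_one, norm_add_sq_real]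
    simp [norm_smul, inner_smul_left, inner_smul_right, h.norm_left, h.norm_right,
      h.inner_eq_zero, hab]
  refine ⟨norm_eq c s hcs, norm_eq (-s) c (by linarith), ?_⟩
  simp only [inner_add_left, inner_add_right, real_inner_smul_left, real_inner_smul_right,
    real_inner_self_eq_norm_sq, h.norm_left, h.norm_right, h.inner_eq_zero, h.symm.inner_eq_zero]
  ring

theorem exists_norm_eq_one_inner_eq_zero (hF : 2 ≤ Module.finrank ℝ F) (f : F) :
    ∃ e : F, ‖e‖ = 1 ∧ inner ℝ e f = 0 := by
  have : FiniteDimensional ℝ F := Module.finite_of_finrank_pos (by omega)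
  have : (ℝ ∙ f)ᗮ ≠ ⊥ := by
    rw [Ne, Submodule.orthogonal_eq_bot_iff]
    intro h
    have := finrank_span_le_card (R := ℝ) ({f} : Set F)
    rw [h, finrank_top, Set.toFinset_card, Fintype.card_unique] at this
    omega
  obtain ⟨w, hw, hw0⟩ := Submodule.exists_mem_ne_zero_of_ne_bot this
  refine ⟨(‖w‖⁻¹ : ℝ) • w, norm_smul_inv_norm hw0, ?_⟩
  rw [real_inner_smul_left, Submodule.mem_orthogonal_singleton_iff_inner_left.mp hw, mul_zero]

theorem exists_eq_norm_smul_of_inner_eq_zero (hF : 2 ≤ Module.finrank ℝ F) {w f : F}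
    (h : inner ℝ w f = 0) : ∃ y : F, ‖y‖ = 1 ∧ inner ℝ y f = 0 ∧ w = ‖w‖ • y := by
  rcases eq_or_ne w 0 with rfl | hw
  · obtain ⟨y, hy, hyf⟩ := exists_norm_eq_one_inner_eq_zero hF f
    exact ⟨y, hy, hyf, by simp⟩
  · refine ⟨(‖w‖⁻¹ : ℝ) • w, norm_smul_inv_norm hw, ?_, ?_⟩
    · rw [real_inner_smul_left, h, mul_zero]
    · rw [smul_inv_smul₀ (norm_ne_zero_iff.mpr hw)]

theorem exists_orthonormalPair_eq_norm_smul (hF : 2 ≤ Module.finrank ℝ F) {v w : F}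
    (h : inner ℝ v w = 0) : ∃ y x : F, OrthonormalPair y x ∧ v = ‖v‖ • y ∧ w = ‖w‖ • x := by
  obtain ⟨x, hx, hxv, hw⟩ := exists_eq_norm_smul_of_inner_eq_zero hF
    (real_inner_comm v w ▸ h : inner ℝ w v = 0)
  obtain ⟨y, hy, hyx, hv⟩ := exists_eq_norm_smul_of_inner_eq_zero hF
    (real_inner_comm v x ▸ hxv : inner ℝ v x = 0)
  exact ⟨y, x, ⟨hy, hx, hyx⟩, hv, hw⟩

/-- A rotation by a right angle changes the sign of the inner product, so the intermediate value
theorem applies. -/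
theorem exists_rotation_inner_eq_zero (v w : F) :
    ∃ c s : ℝ, c ^ 2 + s ^ 2 = 1 ∧ inner ℝ (c • v + s • w) (-s • v + c • w) = 0 := by
  set g : ℝ → ℝ := fun t =>
    inner ℝ (Real.cos t • v + Real.sin t • w) (-Real.sin t • v + Real.cos t • w) with hg
  have hcont : ContinuousOn g (Set.uIcc 0 (Real.pi / 2)) := by fun_prop
  have g_zero : g 0 = inner ℝ v w := by simp [hg]
  have g_pi : g (Real.pi / 2) = -inner ℝ v w := by simp [hg, real_inner_comm]
  obtain ⟨t, -, ht⟩ := intermediate_value_uIcc hcont <| show (0 : ℝ) ∈ Set.uIcc (g 0) _ by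
    rw [g_zero, g_pi, Set.mem_uIcc]
    rcases le_total (inner ℝ v w) 0 with h | h
    · exact Or.inl ⟨h, neg_nonneg.mpr h⟩
    · exact Or.inr ⟨neg_nonpos.mpr h, h⟩
  exact ⟨_, _, Real.cos_sq_add_sin_sq t, ht⟩

theorem exists_polar_coordinates (a b : ℝ) :
    ∃ p c s : ℝ, 0 ≤ p ∧ c ^ 2 + s ^ 2 = 1 ∧ a = p * c ∧ b = p * s :=
  ⟨‖(⟨a, b⟩ : ℂ)‖, _, _, norm_nonneg _, Real.cos_sq_add_sin_sq (Complex.arg ⟨a, b⟩),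
    (Complex.norm_mul_cos_arg ⟨a, b⟩).symm, (Complex.norm_mul_sin_arg ⟨a, b⟩).symm⟩

end Planes

section CliffordPair

variable {F : Type*} [NormedAddCommGroup F] [InnerProductSpace ℝ F]
  {V : Type*} [NormedAddCommGroup V] [InnerProductSpace ℂ V]

/-- Two families `α`, `β` of symmetric operators satisfying the Clifford relations and related by
`β v = α v J`, for a skew complex structure `J` anticommuting with all `α v`. For spacetime spinors
these are `α v = 𝐢 v`, `β v = v e₀` and `J = -𝐢 e₀`, so that `Y` and `X` are the expectations of
`α` and `β`; the definition is symmetric in `α` and `β` up to the sign of `J`. -/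
structure IsCliffordPair (α β : F →ₗ[ℝ] Module.End ℂ V) (J : Module.End ℂ V) : Prop where
  isSymmetric_left : ∀ v, (α v).IsSymmetric
  left_mul_self : ∀ v, α v * α v = ‖v‖ ^ 2 • 1
  left_mul_J : ∀ v, α v * J = β v
  J_mul_left : ∀ v, J * α v = -β v
  J_mul_J : J * J = -1
  inner_J : ∀ ψ χ, inner ℂ (J ψ) χ = -inner ℂ ψ (J χ)

namespace IsCliffordPair

variable {α β : F →ₗ[ℝ] Module.End ℂ V} {J : Module.End ℂ V} (h : IsCliffordPair α β J)
include h

theorem right_mul_J (v : F) : β v * J = -α v := by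
  rw [← h.left_mul_J, mul_assoc, h.J_mul_J, mul_neg_one]

theorem J_mul_right (v : F) : J * β v = α v := by
  rw [← h.left_mul_J, ← mul_assoc, h.J_mul_left, neg_mul, h.right_mul_J, neg_neg]

theorem isSymmetric_right (v : F) : (β v).IsSymmetric := by
  intro ψ χ
  have hβ : β v ψ = α v (J ψ) := by rw [← h.left_mul_J, Module.End.mul_apply]
  have hβ' : J (α v χ) = -β v χ := by
    rw [← Module.End.mul_apply, h.J_mul_left, LinearMap.neg_apply]
  rw [hβ, h.isSymmetric_left v, h.inner_J, hβ', inner_neg_right, neg_neg]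

theorem left_mul_right (v w : F) : α v * β w = α v * α w * J := by
  rw [mul_assoc, h.left_mul_J]

theorem right_mul_left (v w : F) : β v * α w = -(α v * β w) := by
  rw [← h.left_mul_J v, mul_assoc, h.J_mul_left, mul_neg]

theorem right_mul_right (v w : F) : β v * β w = α v * α w := by
  rw [← h.left_mul_J v, mul_assoc, h.J_mul_right]

theorem symm : IsCliffordPair β α (-J) where
  isSymmetric_left := h.isSymmetric_right
  left_mul_self v := by rw [h.right_mul_right, h.left_mul_self]
  left_mul_J v := by rw [mul_neg, h.right_mul_J, neg_neg]
  J_mul_left v := by rw [neg_mul, h.J_mul_right]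
  J_mul_J := by rw [neg_mul_neg, h.J_mul_J]
  inner_J ψ χ := by
    rw [LinearMap.neg_apply, LinearMap.neg_apply, inner_neg_left, inner_neg_right, h.inner_J]

theorem rotate {c s : ℝ} (hcs : c ^ 2 + s ^ 2 = 1) :
    IsCliffordPair (c • α + s • β) (-s • α + c • β) J where
  isSymmetric_left v :=
    ((h.isSymmetric_left v).smul (Complex.conj_ofReal c)).add
      ((h.isSymmetric_right v).smul (Complex.conj_ofReal s))
  left_mul_self v := by
    simp only [LinearMap.add_apply, LinearMap.smul_apply, mul_add, add_mul, smul_mul_smul_comm,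
      h.right_mul_left, h.right_mul_right, h.left_mul_self]
    have : c * c + s * s = 1 := by linarith
    linear_combination (norm := module) this • (‖v‖ ^ 2 • (1 : Module.End ℂ V))
  left_mul_J v := by
    simp only [LinearMap.add_apply, LinearMap.smul_apply, add_mul, smul_mul_assoc, h.left_mul_J,
      h.right_mul_J]
    module
  J_mul_left v := by
    simp only [LinearMap.add_apply, LinearMap.smul_apply, mul_add, mul_smul_comm, h.J_mul_left,
      h.J_mul_right]
    module
  J_mul_J := h.J_mul_J
  inner_J := h.inner_J

theorem norm_left_apply (v : F) (ψ : V) : ‖α v ψ‖ = ‖v‖ * ‖ψ‖ := by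
  rw [← sq_eq_sq₀ (norm_nonneg _) (by positivity), norm_apply_sq (h.isSymmetric_left v),
    h.left_mul_self, map_smul, expectation_one, smul_eq_mul, mul_pow]

theorem left_mul_add_left_mul (v w : F) : α v * α w + α w * α v = (2 * inner ℝ v w) • 1 := by
  have hsum := h.left_mul_self (v + w)
  rw [map_add, add_mul, mul_add, mul_add, h.left_mul_self, h.left_mul_self,
    norm_add_sq_real] at hsum
  linear_combination (norm := module) hsum

theorem left_mul_left_of_inner_eq_zero {v w : F} (hvw : inner ℝ v w = 0) :
    α v * α w = -(α w * α v) := by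
  rw [eq_neg_iff_add_eq_zero, h.left_mul_add_left_mul, hvw, mul_zero, zero_smul]

theorem left_mul_right_of_inner_eq_zero {v w : F} (hvw : inner ℝ v w = 0) :
    α v * β w = -(α w * β v) := by
  rw [h.left_mul_right, h.left_mul_left_of_inner_eq_zero hvw, neg_mul, ← h.left_mul_right]

theorem commute_of_inner_eq_zero {v w : F} (hvw : inner ℝ v w = 0) : Commute (α v) (β w) := by
  rw [commute_iff_eq, h.right_mul_left, h.left_mul_right_of_inner_eq_zero hvw]

theorem left_mul_right_self (v : F) : α v * β v = ‖v‖ ^ 2 • J := by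
  rw [h.left_mul_right, h.left_mul_self, smul_mul_assoc, one_mul]

theorem left_mul_right_rotate {e f : F} (hef : OrthonormalPair e f) {c s : ℝ}
    (hcs : c ^ 2 + s ^ 2 = 1) : α (c • e + s • f) * β (-s • e + c • f) = α e * β f := by
  simp only [map_add, map_smul, mul_add, add_mul, smul_mul_smul_comm, h.left_mul_right_self,
    hef.norm_left, hef.norm_right, h.left_mul_right_of_inner_eq_zero hef.symm.inner_eq_zero]
  linear_combination (norm := module) hcs • (α e * β f)

theorem left_reflection_mul (w v : F) :
    α ((ℝ ∙ w).reflection v) * α w = α w * α v := by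
  rcases eq_or_ne w 0 with rfl | hw
  · simp
  · have hw' : ‖w‖ ^ 2 ≠ 0 := pow_ne_zero 2 (norm_ne_zero_iff.mpr hw)
    have : α ((ℝ ∙ w).reflection v) = (2 * (inner ℝ w v / ‖w‖ ^ 2)) • α w - α v := by
      rw [Submodule.reflection_singleton_apply, map_sub, two_smul, map_add, map_smul]
      simp only [RCLike.ofReal_real_eq_id, id_eq]
      module
    rw [this, sub_mul, smul_mul_assoc, h.left_mul_self, smul_smul, mul_assoc,
      div_mul_cancel₀ _ hw', ← h.left_mul_add_left_mul, add_sub_cancel_right]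

theorem right_reflection_mul (w v : F) :
    β ((ℝ ∙ w).reflection v) * α w = -(α w * β v) := by
  rw [h.right_mul_left, h.left_mul_right, h.left_reflection_mul, ← h.left_mul_right]

end IsCliffordPair

end CliffordPair

section MinimizingPair

variable {F : Type*} [NormedAddCommGroup F] [InnerProductSpace ℝ F]
  {V : Type*} [NormedAddCommGroup V] [InnerProductSpace ℂ V]
  {α β : F →ₗ[ℝ] Module.End ℂ V} {J H : Module.End ℂ V}

/-- There are orthonormal vectors `y`, `x` such that every state fixed by `α y` and `β x` minimizes
the expectation of `H` among the states of the same norm. -/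
def HasMinimizingPair (α β : F →ₗ[ℝ] Module.End ℂ V) (H : Module.End ℂ V) : Prop :=
  ∃ y x : F, OrthonormalPair y x ∧ ∀ u : V, α y u = u → β x u = u →
    IsMinOn (fun v => expectation v H) (Metric.sphere 0 ‖u‖) u

theorem HasMinimizingPair.symm (hH : HasMinimizingPair α β H) : HasMinimizingPair β α H := by
  obtain ⟨y, x, hyx, hmin⟩ := hH
  exact ⟨x, y, hyx.symm, fun u hx hy => hmin u hy hx⟩

theorem HasMinimizingPair.smul_one_add (hH : HasMinimizingPair α β H) (r : ℝ) :
    HasMinimizingPair α β (r • 1 + H) := by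
  obtain ⟨y, x, hyx, hmin⟩ := hH
  refine ⟨y, x, hyx, fun u hy hx v hv => ?_⟩
  have hvu : ‖v‖ = ‖u‖ := by simpa using hv
  simpa [expectation_one, hvu] using hmin u hy hx hv

namespace IsCliffordPair

variable (h : IsCliffordPair α β J)
include h

theorem J_apply_of_fixed {x : F} {u : V} (hx : ‖x‖ = 1) (hu : β x u = u) : J u = α x u := by
  have := LinearMap.congr_fun (h.left_mul_right_self x) u
  rwa [Module.End.mul_apply, hu, hx, one_pow, one_smul, eq_comm] at this

theorem right_apply_of_fixed {y x : F} {u : V} (hyx : OrthonormalPair y x) (hy : α y u = u)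
    (hx : β x u = u) : β y u = -α x u := by
  have := LinearMap.congr_fun (h.J_mul_left y) u
  rw [Module.End.mul_apply, hy, h.J_apply_of_fixed hyx.norm_right hx] at this
  rw [this, LinearMap.neg_apply, neg_neg]

theorem hasMinimizingPair_of_rotate {c s : ℝ} (hcs : c ^ 2 + s ^ 2 = 1)
    (hH : HasMinimizingPair (c • α + s • β) (-s • α + c • β) H) : HasMinimizingPair α β H := by
  obtain ⟨y, x, hyx, hmin⟩ := hH
  have hyx' : OrthonormalPair (c • y + -s • x) (s • y + c • x) := by
    simpa only [neg_neg] using hyx.rotate (c := c) (s := -s) (by linarith)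
  refine ⟨_, _, hyx', fun u hY hX => ?_⟩
  have hαX := h.J_apply_of_fixed hyx'.norm_right hX
  have hβY := h.right_apply_of_fixed hyx' hY hX
  have hy : y = c • (c • y + -s • x) + s • (s • y + c • x) := by
    linear_combination (norm := module) -hcs • y
  have hx : x = -s • (c • y + -s • x) + c • (s • y + c • x) := by
    linear_combination (norm := module) -hcs • x
  generalize c • y + -s • x = Y at *
  generalize s • y + c • x = X at *
  refine hmin u ?_ ?_
  · rw [hy]
    simp only [LinearMap.add_apply, LinearMap.smul_apply, map_add, map_smul, hY, hX, ← hαX, hβY]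
    linear_combination (norm := module) hcs • u
  · rw [hx]
    simp only [LinearMap.add_apply, LinearMap.smul_apply, map_add, map_smul, hY, hX, ← hαX, hβY]
    linear_combination (norm := module) hcs • u

theorem hasMinimizingPair_add_of_inner_eq_zero (hF : 2 ≤ Module.finrank ℝ F) {P C : F}
    (hPC : inner ℝ P C = 0) : HasMinimizingPair α β (α P + β C) := by
  obtain ⟨y, x, hyx, hP, hC⟩ := exists_orthonormalPair_eq_norm_smul hF
    (by simpa using hPC : inner ℝ (-P) (-C) = 0)
  refine ⟨y, x, hyx, fun u hy hx => isMinOn_expectation (m := ‖P‖ + ‖C‖) (fun ψ => ?_) ?_⟩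
  · calc ‖(α P + β C) ψ‖ ≤ ‖α P ψ‖ + ‖β C ψ‖ := norm_add_le _ _
      _ = (‖P‖ + ‖C‖) * ‖ψ‖ := by
        rw [h.norm_left_apply, h.symm.norm_left_apply, add_mul]
  · rw [norm_neg, neg_eq_iff_eq_neg, ← smul_neg] at hP hC
    rw [LinearMap.add_apply, hP, hC]
    simp only [map_smul, map_neg, LinearMap.smul_apply, LinearMap.neg_apply, hy, hx, norm_smul,
      norm_neg, norm_norm, hyx.norm_left, hyx.norm_right]
    module

theorem hasMinimizingPair_add (hF : 2 ≤ Module.finrank ℝ F) (P C : F) :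
    HasMinimizingPair α β (α P + β C) := by
  obtain ⟨c, s, hcs, horth⟩ := exists_rotation_inner_eq_zero P C
  refine h.hasMinimizingPair_of_rotate hcs ?_
  convert (h.rotate hcs).hasMinimizingPair_add_of_inner_eq_zero hF horth using 1
  simp only [LinearMap.add_apply, LinearMap.smul_apply, map_add, map_smul]
  linear_combination (norm := module) -hcs • (α P + β C)

/-- The square of `α w + b α(e) β(f)` is a linear combination of the identity and the symmetric
involution `β f`, because `α(e) β(f)` commutes with the component of `α w` along `e` and
anticommutes with the component orthogonal to `e`. -/
theorem left_add_smul_left_mul_right_sq {e f w : F} (hef : OrthonormalPair e f)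
    (hwf : inner ℝ w f = 0) (b : ℝ) :
    (α w + b • (α e * β f)) * (α w + b • (α e * β f)) =
      (‖w‖ ^ 2 + b ^ 2) • 1 + (2 * b * inner ℝ w e) • β f := by
  have cross : α w * (α e * β f) + α e * β f * α w = (2 * inner ℝ w e) • β f := by
    rw [mul_assoc, ← (h.commute_of_inner_eq_zero hwf).eq, ← mul_assoc, ← mul_assoc, ← add_mul,
      h.left_mul_add_left_mul, smul_mul_assoc, one_mul]
  have sq : α e * β f * (α e * β f) = 1 := by
    rw [mul_assoc, ← mul_assoc (β f), ← (h.commute_of_inner_eq_zero hef.inner_eq_zero).eq,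
      mul_assoc (α e) (β f), ← mul_assoc (α e), h.left_mul_self, h.symm.left_mul_self,
      hef.norm_left, hef.norm_right]
    simp
  simp only [mul_add, add_mul, mul_smul_comm, smul_mul_assoc, h.left_mul_self, sq]
  linear_combination (norm := module) b • cross

theorem isSymmetric_left_mul_right {e f : F} (hef : inner ℝ e f = 0) :
    (α e * β f).IsSymmetric :=
  (h.isSymmetric_left e).mul_of_commute (h.isSymmetric_right f) (h.commute_of_inner_eq_zero hef)

theorem norm_left_add_smul_left_mul_right_le {e f w : F} (hef : OrthonormalPair e f)
    (hwf : inner ℝ w f = 0) (hwe : 0 ≤ inner ℝ w e) {b : ℝ} (hb : 0 ≤ b) (ψ : V) :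
    ‖(α w + b • (α e * β f)) ψ‖ ≤ ‖w + b • e‖ * ‖ψ‖ := by
  have hsymm : (α w + b • (α e * β f)).IsSymmetric :=
    (h.isSymmetric_left w).add
      ((h.isSymmetric_left_mul_right hef.inner_eq_zero).smul (Complex.conj_ofReal b))
  have norm_sq : ‖w + b • e‖ ^ 2 = ‖w‖ ^ 2 + b ^ 2 + 2 * b * inner ℝ w e := by
    rw [norm_add_sq_real, inner_smul_right, norm_smul, hef.norm_left, mul_one, Real.norm_eq_abs,
      sq_abs]
    ring
  have hβ : expectation ψ (β f) ≤ ‖ψ‖ ^ 2 := by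
    simpa [h.symm.norm_left_apply, hef.norm_right, sq] using
      (le_abs_self _).trans (abs_expectation_le ψ (β f))
  rw [← sq_le_sq₀ (norm_nonneg _) (by positivity), norm_apply_sq hsymm,
    h.left_add_smul_left_mul_right_sq hef hwf, map_add, map_smul, map_smul, expectation_one,
    mul_pow, norm_sq, smul_eq_mul, smul_eq_mul, add_mul (‖w‖ ^ 2 + b ^ 2)]
  gcongr

theorem hasMinimizingPair_neg_left_add_smul (hF : 2 ≤ Module.finrank ℝ F) {e f w : F}
    (hef : OrthonormalPair e f) (hwf : inner ℝ w f = 0) (hwe : 0 ≤ inner ℝ w e) {b : ℝ}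
    (hb : 0 ≤ b) : HasMinimizingPair α β (-(α w + b • (α e * β f))) := by
  have hwf' : inner ℝ (w + b • e) f = 0 := by
    rw [inner_add_left, real_inner_smul_left, hwf, hef.inner_eq_zero, mul_zero, add_zero]
  obtain ⟨y, hy, hyf, hw⟩ := exists_eq_norm_smul_of_inner_eq_zero hF hwf'
  refine ⟨y, f, ⟨hy, hef.norm_right, hyf⟩, fun u hyu hfu =>
    isMinOn_expectation (m := ‖w + b • e‖) (fun ψ => ?_) ?_⟩
  · rw [LinearMap.neg_apply, norm_neg]
    exact h.norm_left_add_smul_left_mul_right_le hef hwf hwe hb ψ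
  · have : α (w + b • e) u = ‖w + b • e‖ • u := by
      rw [hw, map_smul, LinearMap.smul_apply, hyu, norm_smul, hy, norm_norm, mul_one]
    rw [← this, LinearMap.neg_apply, map_add, map_smul]
    simp [hfu]

theorem hasMinimizingPair_left_sub_smul (hF : 2 ≤ Module.finrank ℝ F) {e f : F}
    (hef : OrthonormalPair e f) (P : F) {b : ℝ} (hb : 0 ≤ b) :
    HasMinimizingPair α β (α P - b • (α e * β f)) := by
  obtain ⟨p, c, s, hp, hcs, he, hf⟩ := exists_polar_coordinates (inner ℝ (-P) e) (inner ℝ (-P) f)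
  have hPe : inner ℝ (-P) (c • e + s • f) = p := by
    rw [inner_add_right, real_inner_smul_right, real_inner_smul_right, he, hf]
    linear_combination p * hcs
  have hPf : inner ℝ (-P) (-s • e + c • f) = 0 := by
    rw [inner_add_right, real_inner_smul_right, real_inner_smul_right, he, hf]
    ring
  have := h.hasMinimizingPair_neg_left_add_smul hF (hef.rotate hcs) hPf (hp.trans_eq hPe.symm) hb
  rwa [h.left_mul_right_rotate hef hcs, map_neg, neg_add, neg_neg, ← sub_eq_add_neg] at this

theorem hasMinimizingPair_left_add_smul (hF : 2 ≤ Module.finrank ℝ F) {e f : F}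
    (hef : OrthonormalPair e f) (P : F) (a : ℝ) :
    HasMinimizingPair α β (α P + a • (α e * β f)) := by
  rcases le_total a 0 with ha | ha
  · simpa using h.hasMinimizingPair_left_sub_smul hF hef P (neg_nonneg.mpr ha)
  · rw [h.left_mul_right_of_inner_eq_zero hef.inner_eq_zero, smul_neg, ← sub_eq_add_neg]
    exact h.hasMinimizingPair_left_sub_smul hF hef.symm P ha

theorem hasMinimizingPair_right_add_smul (hF : 2 ≤ Module.finrank ℝ F) {e f : F}
    (hef : OrthonormalPair e f) (C : F) (a : ℝ) :
    HasMinimizingPair α β (β C + a • (α e * β f)) := by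
  have := (h.symm.hasMinimizingPair_left_add_smul hF hef C (-a)).symm
  rwa [h.right_mul_left, neg_smul_neg] at this

end IsCliffordPair

end MinimizingPair

section SpinorOperators

variable {n : ℕ} {S : Type*} [NormedAddCommGroup S] [InnerProductSpace ℂ S]

theorem SpinorModule.nontrivial (c : SpinorModule n S) : Nontrivial S :=
  Module.nontrivial_of_finrank_pos (R := ℂ) (by rw [c.finrank_eq]; positivity)

theorem SpinorModule.cliff_cliff_of_inner_eq_zero (c : SpinorModule n S) {v w : E n}
    (hvw : inner ℝ v w = 0) (ψ : S) : c.cliff v (c.cliff w ψ) = -c.cliff w (c.cliff v ψ) := by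
  have hsq := c.cliff_sq (v + w) ψ
  have hnorm : ‖v + w‖ ^ 2 = ‖v‖ ^ 2 + ‖w‖ ^ 2 := by rw [norm_add_sq_real, hvw]; ring
  simp only [map_add, LinearMap.add_apply, c.cliff_sq, hnorm, Complex.ofReal_add] at hsq
  linear_combination (norm := module) hsq

theorem SpinorModule.exists_I_smul_cliff_eq_self (c : SpinorModule n S) {y x : E n}
    (hyx : OrthonormalPair y x) : ∃ φ : S, φ ≠ 0 ∧ Complex.I • c.cliff y φ = φ := by
  have := c.nontrivial
  obtain ⟨w, hw⟩ := exists_ne (0 : S)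
  have hyy : c.cliff y (c.cliff y w) = -w := by simp [c.cliff_sq, hyx.norm_left]
  by_cases hyw : Complex.I • c.cliff y w = -w
  · refine ⟨c.cliff x w, fun hxw => hw ?_, ?_⟩
    · simpa [hxw, hyx.norm_right] using c.cliff_sq x w
    · rw [c.cliff_cliff_of_inner_eq_zero hyx.inner_eq_zero, smul_neg, ← map_smul, hyw, map_neg,
        neg_neg]
  · refine ⟨w + Complex.I • c.cliff y w, fun h0 => hyw (eq_neg_of_add_eq_zero_right h0), ?_⟩
    rw [map_add, map_smul, hyy, smul_add, smul_smul, Complex.I_mul_I, neg_one_smul, neg_neg,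
      add_comm]

/-- `spaceMul` as a linear map into the operators. -/
noncomputable def spaceOp (c : SpinorModule n S) : E n →ₗ[ℝ] Module.End ℂ (DoubleSpinor S) where
  toFun v :=
    { toFun := spaceMul c v
      map_add' := fun ψ χ => WithLp.ofLp_injective 2 <|
        Prod.ext (by simp [spaceMul]) (by simp [spaceMul]; abel)
      map_smul' := spaceMul_smul c v }
  map_add' v w := LinearMap.ext fun ψ => WithLp.ofLp_injective 2 <|
    Prod.ext (by simp [spaceMul]) (by simp [spaceMul]; abel)
  map_smul' r v := LinearMap.ext fun ψ => WithLp.ofLp_injective 2 <|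
    Prod.ext (by simp [spaceMul]) (by simp [spaceMul])

/-- `timeMul` as an operator. -/
noncomputable def timeOp (S : Type*) [NormedAddCommGroup S] [InnerProductSpace ℂ S] :
    Module.End ℂ (DoubleSpinor S) where
  toFun := timeMul
  map_add' _ _ := rfl
  map_smul' _ _ := rfl

/-- The operators `v e₀`, whose expectations are the components of `X`. -/
noncomputable def opX (c : SpinorModule n S) : E n →ₗ[ℝ] Module.End ℂ (DoubleSpinor S) :=
  LinearMap.mulRight ℝ (timeOp S) ∘ₗ spaceOp c

/-- The operators `𝐢 v`, whose expectations are the components of `Y`. -/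
noncomputable def opY (c : SpinorModule n S) : E n →ₗ[ℝ] Module.End ℂ (DoubleSpinor S) :=
  Complex.I • spaceOp c

variable (c : SpinorModule n S)

theorem opX_apply (v : E n) (ψ : DoubleSpinor S) : opX c v ψ = spaceMul c v (timeMul ψ) := rfl

theorem opY_apply (v : E n) (ψ : DoubleSpinor S) : opY c v ψ = Complex.I • spaceMul c v ψ := rfl

theorem timeOp_apply (ψ : DoubleSpinor S) : timeOp S ψ = timeMul ψ := rfl

theorem timeOp_mul_self : timeOp S * timeOp S = 1 := rfl

theorem timeOp_mul_spaceOp (v : E n) : timeOp S * spaceOp c v = -(spaceOp c v * timeOp S) :=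
  LinearMap.ext fun ψ => WithLp.ofLp_injective 2 <|
    Prod.ext rfl (neg_neg (c.cliff v ψ.fst)).symm

theorem isSymmetric_timeOp : (timeOp S).IsSymmetric := fun ψ χ => by
  rw [timeOp_apply, timeOp_apply, WithLp.prod_inner_apply, WithLp.prod_inner_apply]
  exact add_comm _ _

theorem inner_spaceMul (v : E n) (ψ χ : DoubleSpinor S) :
    inner ℂ (spaceMul c v ψ) χ = -inner ℂ ψ (spaceMul c v χ) := by
  simp [spaceMul, WithLp.prod_inner_apply, c.cliff_skew, add_comm]

theorem isCliffordPair_opY_opX : IsCliffordPair (opY c) (opX c) (-(Complex.I • timeOp S)) where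
  isSymmetric_left v ψ χ := by
    simp only [opY_apply, inner_smul_left, inner_smul_right, inner_spaceMul, Complex.conj_I]
    ring
  left_mul_self v := LinearMap.ext fun ψ => by
    simp only [Module.End.mul_apply, opY_apply, spaceMul_smul, spaceMul_sq, smul_neg, smul_smul,
      Complex.I_mul_I, neg_one_smul, neg_neg, Complex.coe_smul]
    rfl
  left_mul_J v := by
    simp [opY, opX, smul_smul]
  J_mul_left v := by
    simp [opY, opX, smul_smul, timeOp_mul_spaceOp]
  J_mul_J := by
    simp [smul_smul, timeOp_mul_self]
  inner_J ψ χ := by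
    simp [inner_smul_left, inner_smul_right, isSymmetric_timeOp ψ χ]

theorem exists_ne_zero_opY_opX_fixed {y x : E n} (hyx : OrthonormalPair y x) :
    ∃ u : DoubleSpinor S, u ≠ 0 ∧ opY c y u = u ∧ opX c x u = u := by
  obtain ⟨φ, hφ, hyφ⟩ := c.exists_I_smul_cliff_eq_self hyx
  refine ⟨WithLp.toLp 2 (φ, -c.cliff x φ), fun h0 => hφ (congrArg (fun w => w.fst) h0), ?_, ?_⟩ <;>
    refine WithLp.ofLp_injective 2 (Prod.ext ?_ ?_)
  · simpa [opY_apply, spaceMul] using hyφ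
  · have hyxφ : Complex.I • c.cliff y (c.cliff x φ) = -c.cliff x φ := by
      rw [c.cliff_cliff_of_inner_eq_zero hyx.inner_eq_zero, smul_neg, ← map_smul, hyφ]
    simpa [opY_apply, spaceMul] using hyxφ
  · simp [opX_apply, spaceMul, timeMul, c.cliff_sq, hyx.norm_right]
  · simp [opX_apply, spaceMul, timeMul]

theorem sum_smul_stdVec (v : E n) : ∑ i, v i • stdVec i = v := by
  simpa [stdVec] using (EuclideanSpace.basisFun (Fin n) ℝ).sum_repr v

theorem inner_eq_expectation {T : E n →ₗ[ℝ] Module.End ℂ (DoubleSpinor S)} {ψ : DoubleSpinor S}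
    {w : E n} (hw : ∀ i, w i = expectation ψ (T (stdVec i))) (v : E n) :
    inner ℝ v w = expectation ψ (T v) := by
  conv_rhs => rw [← sum_smul_stdVec v]
  simp [PiLp.inner_apply, hw, mul_comm]

theorem inner_currentX (ψ : DoubleSpinor S) (v : E n) :
    inner ℝ v (currentX c ψ) = expectation ψ (opX c v) :=
  inner_eq_expectation (fun _ => rfl) v

theorem inner_currentY (ψ : DoubleSpinor S) (v : E n) :
    inner ℝ v (currentY c ψ) = expectation ψ (opY c v) :=
  inner_eq_expectation (fun _ => rfl) v

theorem isNull_of_opX_fixed {ψ : DoubleSpinor S} {x : E n} (hx : ‖x‖ = 1) (hψ : opX c x ψ = ψ) :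
    IsNull c ψ := by
  refine norm_eq_of_inner_le hx ?_ fun v => ?_
  · rw [inner_currentX, expectation_of_fixed hψ, currentN]
  · rw [inner_currentX, currentN, sq, mul_left_comm,
      ← (isCliffordPair_opY_opX c).symm.norm_left_apply]
    exact (le_abs_self _).trans (abs_expectation_le _ _)

theorem isTypeI_of_opY_fixed {ψ : DoubleSpinor S} {y : E n} (hy : ‖y‖ = 1) (hψ : opY c y ψ = ψ) :
    IsTypeI c ψ := by
  refine (norm_eq_of_inner_le hy ?_ fun v => ?_).symm
  · rw [inner_currentY, expectation_of_fixed hψ, currentN]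
  · rw [inner_currentY, currentN, sq, mul_left_comm, ← (isCliffordPair_opY_opX c).norm_left_apply]
    exact (le_abs_self _).trans (abs_expectation_le _ _)

theorem killingSpinor_eq_opY (u : DoubleSpinor S) (z : E n) :
    killingSpinor c u z = ((xi z ^ (-(1 / 2) : ℝ) : ℝ) : ℂ) • (1 - opY c z) u := rfl

theorem killingSpinor_of_opY_fixed {u : DoubleSpinor S} {y : E n} (hu : opY c y u = u) (z : E n) :
    killingSpinor c u z = ((xi z ^ (-(1 / 2) : ℝ) : ℝ) : ℂ) • opY c (y - z) u := by
  rw [killingSpinor_eq_opY, map_sub, LinearMap.sub_apply, LinearMap.sub_apply, hu,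
    Module.End.one_apply]

theorem isNull_killingSpinor {u : DoubleSpinor S} {y x : E n} (hx : ‖x‖ = 1)
    (hyu : opY c y u = u) (hxu : opX c x u = u) (z : E n) : IsNull c (killingSpinor c u z) := by
  refine isNull_of_opX_fixed c (x := -(ℝ ∙ (y - z)).reflection x)
    (by rw [norm_neg, LinearIsometryEquiv.norm_map, hx]) ?_
  rw [killingSpinor_of_opY_fixed c hyu, map_smul, map_neg, LinearMap.neg_apply,
    ← Module.End.mul_apply, (isCliffordPair_opY_opX c).right_reflection_mul, LinearMap.neg_apply,
    neg_neg, Module.End.mul_apply, hxu]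

theorem isTypeI_killingSpinor {u : DoubleSpinor S} {y : E n} (hy : ‖y‖ = 1) (hyu : opY c y u = u)
    (z : E n) : IsTypeI c (killingSpinor c u z) := by
  refine isTypeI_of_opY_fixed c (y := (ℝ ∙ (y - z)).reflection y)
    (by rw [LinearIsometryEquiv.norm_map, hy]) ?_
  rw [killingSpinor_of_opY_fixed c hyu, map_smul, ← Module.End.mul_apply,
    (isCliffordPair_opY_opX c).left_reflection_mul, Module.End.mul_apply, hyu]

end SpinorOperators

section Ends

open MeasureTheory Filter

variable {n : ℕ}

theorem abs_ballRadius_lt_one (R : ℝ) : |ballRadius R| < 1 := by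
  have hR : |R| < 1 + √(1 + R ^ 2) := by
    linarith [Real.abs_le_sqrt (show R ^ 2 ≤ 1 + R ^ 2 by linarith)]
  have hpos : 0 < 1 + √(1 + R ^ 2) := by positivity
  rwa [ballRadius, abs_div, abs_of_pos hpos, div_lt_one hpos]

theorem areaRadius_ballRadius_smul {R : ℝ} (hR : 0 ≤ R) {σ : E n} (hσ : ‖σ‖ = 1) :
    areaRadius (ballRadius R • σ) = R := by
  have hsqrt : √(1 + R ^ 2) ^ 2 = 1 + R ^ 2 := Real.sq_sqrt (by positivity)
  have hpos : 0 < 1 + √(1 + R ^ 2) := by positivity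
  have hballRadius : 1 - ballRadius R ^ 2 = 2 / (1 + √(1 + R ^ 2)) := by
    rw [ballRadius]
    field_simp
    linear_combination hsqrt
  have hnonneg : 0 ≤ ballRadius R := div_nonneg hR hpos.le
  rw [areaRadius, norm_smul, hσ, mul_one, Real.norm_of_nonneg hnonneg, hballRadius, ballRadius]
  field_simp

theorem ballRadius_smul_mem_ball (R : ℝ) {σ : E n} (hσ : ‖σ‖ = 1) :
    ballRadius R • σ ∈ Metric.ball (0 : E n) 1 := by
  rw [mem_ball_zero_iff, norm_smul, hσ, mul_one]
  exact abs_ballRadius_lt_one R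

theorem xi_pos {z : E n} (hz : z ∈ Metric.ball (0 : E n) 1) : 0 < xi z := by
  rw [mem_ball_zero_iff] at hz
  unfold xi
  nlinarith [norm_nonneg z]

theorem exterior_subset_ball (R₀ : ℝ) : exterior n R₀ ⊆ Metric.ball (0 : E n) 1 :=
  fun _ hz => mem_ball_zero_iff.2 hz.1

theorem isOpen_exterior (R₀ : ℝ) : IsOpen (exterior n R₀) := by
  have hcont : ContinuousOn (areaRadius (n := n)) (Metric.ball 0 1) := by
    refine ContinuousOn.div (by fun_prop) (by fun_prop) fun z hz => ?_
    have := xi_pos hz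
    unfold xi at this
    linarith
  convert hcont.isOpen_inter_preimage Metric.isOpen_ball (isOpen_Ioi (a := R₀)) using 1
  ext z
  simp [exterior]

theorem contDiff_xi {m : WithTop ℕ∞} : ContDiff ℝ m (xi (n := n)) :=
  (contDiff_const.sub (contDiff_norm_sq ℝ)).div_const 2

theorem contDiffOn_xi_sq_inv {m : WithTop ℕ∞} :
    ContDiffOn ℝ m (fun z : E n => (xi z ^ 2)⁻¹) (Metric.ball 0 1) :=
  (contDiff_xi.pow 2).contDiffOn.inv fun _ hz => pow_ne_zero 2 (xi_pos hz).ne'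

theorem contDiffOn_hypMetric {m : WithTop ℕ∞} (i j : Fin n) :
    ContDiffOn ℝ m (fun z : E n => hypMetric z i j) (Metric.ball 0 1) := by
  simp only [hypMetric, Matrix.smul_apply, smul_eq_mul]
  exact contDiffOn_xi_sq_inv.mul contDiffOn_const

theorem det_hypMetric_ne_zero {z : E n} (hz : z ∈ Metric.ball (0 : E n) 1) :
    (hypMetric z).det ≠ 0 := by
  rw [hypMetric, Matrix.det_smul, Matrix.det_one, mul_one]
  exact pow_ne_zero _ (inv_ne_zero (pow_ne_zero 2 (xi_pos hz).ne'))

theorem InWeightedHolder.tendsto_zero {R₀ : ℝ} {s : ℕ} {a q : ℝ} {f : E n → ℝ}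
    (hf : InWeightedHolder R₀ s a q f) (hq : 0 < q) :
    Tendsto f (comap areaRadius atTop ⊓ 𝓟 (exterior n R₀)) (𝓝 0) := by
  obtain ⟨C, hC⟩ := hf.2.1
  have hbound : Tendsto (fun z : E n => C * areaRadius z ^ (-q)) (comap areaRadius atTop)
      (𝓝 0) := by
    simpa using ((tendsto_rpow_neg_atTop hq).comp tendsto_comap).const_mul C
  refine squeeze_zero_norm' ?_ (hbound.mono_left inf_le_left)
  refine eventually_inf_principal.2 ?_
  filter_upwards [tendsto_comap.eventually (eventually_gt_atTop 0)] with z hr hz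
  have h := hC [] (Nat.zero_le s) z hz
  rwa [← le_div_iff₀' (Real.rpow_pos_of_pos hr q), div_eq_mul_inv, ← Real.rpow_neg hr.le] at h

/-- Sufficient regularity for the fluxes through the large coordinate spheres to be integrals of
continuous functions: the metric `G` and the second fundamental form `K` of an end are `C¹` and
continuous, and `G` is nondegenerate, on an open subset `U` of the ball that contains these
spheres. -/
structure RegularEnd (G K : E n → Matrix (Fin n) (Fin n) ℝ) (U : Set (E n)) : Prop where
  isOpen : IsOpen U
  subset_ball : U ⊆ Metric.ball 0 1
  eventually_sphere_mem : ∀ᶠ R in atTop, ∀ σ : E n, ‖σ‖ = 1 → ballRadius R • σ ∈ U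
  contDiffOn_metric : ∀ i j, ContDiffOn ℝ 1 (fun z => G z i j) U
  det_ne_zero : ∀ z ∈ U, (G z).det ≠ 0
  continuousOn_form : ∀ i j, ContinuousOn (fun z => K z i j) U

variable {G K : E n → Matrix (Fin n) (Fin n) ℝ} {U : Set (E n)}

theorem contDiffOn_of_xi_sq_mul_sub_hypMetric {m : WithTop ℕ∞} {i j : Fin n}
    (hU : U ⊆ Metric.ball 0 1)
    (hG : ContDiffOn ℝ m (fun z => xi z ^ 2 * (G z i j - hypMetric z i j)) U) :
    ContDiffOn ℝ m (fun z => G z i j) U := by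
  refine ((contDiffOn_xi_sq_inv.mono hU).mul hG |>.add
    ((contDiffOn_hypMetric i j).mono hU)).congr fun z hz => ?_
  have := (xi_pos (hU hz)).ne'
  field_simp
  ring

theorem continuousOn_of_xi_sq_mul {f : E n → ℝ} (hU : U ⊆ Metric.ball 0 1)
    (hf : ContinuousOn (fun z => xi z ^ 2 * f z) U) : ContinuousOn f U :=
  ((contDiffOn_xi_sq_inv (m := 0)).continuousOn.mono hU |>.mul hf).congr fun _ hz =>
    (inv_mul_cancel_left₀ (pow_ne_zero 2 (xi_pos (hU hz)).ne') _).symm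

theorem eventually_det_ne_zero_of_inWeightedHolder {R₀ : ℝ} {s : ℕ} {a q : ℝ} (hq : 0 < q)
    (hG : ∀ i j, InWeightedHolder R₀ s a q (fun z => xi z ^ 2 * (G z i j - hypMetric z i j))) :
    ∀ᶠ z in comap areaRadius atTop ⊓ 𝓟 (exterior n R₀), (G z).det ≠ 0 := by
  have hlim : Tendsto (fun z => xi z ^ 2 • G z)
      (comap areaRadius atTop ⊓ 𝓟 (exterior n R₀)) (𝓝 1) := by
    refine tendsto_pi_nhds.2 fun i => tendsto_pi_nhds.2 fun j => ?_
    have h := ((hG i j).tendsto_zero hq).add_const ((1 : Matrix (Fin n) (Fin n) ℝ) i j)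
    rw [zero_add] at h
    refine h.congr' (eventually_inf_principal.2 (Eventually.of_forall fun z hz => ?_))
    have := (xi_pos (exterior_subset_ball _ hz)).ne'
    simp only [hypMetric, Matrix.smul_apply, smul_eq_mul]
    field_simp
    ring
  have hdet : ∀ᶠ A : Matrix (Fin n) (Fin n) ℝ in 𝓝 1, A.det ≠ 0 :=
    (continuous_id.matrix_det).continuousAt.eventually_ne (by simp)
  filter_upwards [hlim.eventually hdet] with z hz h0
  rw [Matrix.det_smul, h0, mul_zero] at hz
  exact hz rfl

theorem regularEnd_of_inWeightedHolder {R₀ : ℝ} {s : ℕ} {a q : ℝ} (hs : 1 ≤ s) (hq : 0 < q)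
    (hG : ∀ i j, InWeightedHolder R₀ s a q (fun z => xi z ^ 2 * (G z i j - hypMetric z i j)))
    (hK : ∀ i j, ContinuousOn (fun z => xi z ^ 2 * K z i j) (exterior n R₀)) :
    RegularEnd G K (exterior n R₀ ∩ {z | (G z).det ≠ 0}) := by
  have hball := exterior_subset_ball (n := n) R₀
  have hmetric : ∀ i j, ContDiffOn ℝ 1 (fun z => G z i j) (exterior n R₀) := fun i j =>
    contDiffOn_of_xi_sq_mul_sub_hypMetric hball ((hG i j).1.of_le (by exact_mod_cast hs))
  have hcont : ContinuousOn G (exterior n R₀) :=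
    continuousOn_pi.2 fun i => continuousOn_pi.2 fun j => (hmetric i j).continuousOn
  refine ⟨(continuous_id.matrix_det.comp_continuousOn hcont).isOpen_inter_preimage
      (isOpen_exterior R₀) isOpen_compl_singleton, Set.inter_subset_left.trans hball, ?_,
    fun i j => (hmetric i j).mono Set.inter_subset_left, fun z hz => hz.2,
    fun i j => (continuousOn_of_xi_sq_mul hball (hK i j)).mono Set.inter_subset_left⟩
  have hdet := eventually_det_ne_zero_of_inWeightedHolder hq hG
  rw [eventually_inf_principal, eventually_comap] at hdet
  filter_upwards [hdet, eventually_ge_atTop 0, eventually_gt_atTop R₀] with R hdet hR hR₀ σ hσ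
  have hrad := areaRadius_ballRadius_smul hR hσ
  have hext : ballRadius R • σ ∈ exterior n R₀ :=
    ⟨mem_ball_zero_iff.1 (ballRadius_smul_mem_ball R hσ), by rwa [hrad]⟩
  exact ⟨hext, hdet _ hrad hext⟩

theorem continuousOn_matrix_inv {X : Type*} [TopologicalSpace X]
    {A : X → Matrix (Fin n) (Fin n) ℝ} {V : Set X}
    (hA : ∀ i j, ContinuousOn (fun z => A z i j) V) (hdet : ∀ z ∈ V, (A z).det ≠ 0)
    (i j : Fin n) : ContinuousOn (fun z => (A z)⁻¹ i j) V := by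
  have hcont : ContinuousOn A V := continuousOn_pi.2 fun i => continuousOn_pi.2 fun j => hA i j
  refine (((continuous_id.matrix_det.comp_continuousOn hcont).inv₀ hdet).mul
    ((continuous_id.matrix_adjugate.matrix_elem i j).comp_continuousOn hcont)).congr fun z _ => ?_
  simp [Matrix.inv_def, Ring.inverse_eq_inv']

theorem continuousOn_partialD {f : E n → ℝ} (hU : IsOpen U) (hf : ContDiffOn ℝ 1 f U)
    (i : Fin n) : ContinuousOn (partialD i f) U :=
  (hf.continuousOn_fderiv_of_isOpen hU le_rfl).clm_apply continuousOn_const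

theorem continuousOn_christoffel (hU : IsOpen U)
    (hG : ∀ i j, ContDiffOn ℝ 1 (fun z => G z i j) U) (hdet : ∀ z ∈ U, (G z).det ≠ 0)
    (m i j : Fin n) : ContinuousOn (fun z => christoffel G z m i j) U := by
  have hinv := continuousOn_matrix_inv (fun i j => (hG i j).continuousOn) hdet
  have hpartial := fun m i j => continuousOn_partialD hU (hG i j) m
  unfold christoffel
  exact continuousOn_const.mul (continuousOn_finsetSum _ fun l _ =>
    (hinv m l).mul (((hpartial i j l).add (hpartial j i l)).sub (hpartial l i j)))

theorem continuousOn_covD {T : E n → Matrix (Fin n) (Fin n) ℝ} (hU : IsOpen U)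
    (hG : ∀ i j, ContDiffOn ℝ 1 (fun z => G z i j) U) (hdet : ∀ z ∈ U, (G z).det ≠ 0)
    (hT : ∀ i j, ContDiffOn ℝ 1 (fun z => T z i j) U) (m i j : Fin n) :
    ContinuousOn (fun z => covD G T z m i j) U := by
  have hcont := fun i j => (hT i j).continuousOn
  have hchr := continuousOn_christoffel hU hG hdet
  unfold covD
  exact (continuousOn_partialD hU (hT i j) m).sub (continuousOn_finsetSum _ fun l _ =>
    ((hchr l m i).mul (hcont l j)).add ((hchr l m j).mul (hcont i l)))

/-- A lapse function and a shift vector field on the ball that are regular enough for their flux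
integrands to be continuous. -/
structure RegularLapseShift (N : E n → ℝ) (X : E n → Fin n → ℝ) : Prop where
  contDiffOn_lapse : ContDiffOn ℝ 1 N (Metric.ball 0 1)
  continuousOn_shift : ∀ i, ContinuousOn (fun z => X z i) (Metric.ball 0 1)

/-- The integrand, on the unit sphere, of the flux through the sphere of area radius `R`. -/
noncomputable def fluxDensity (G K : E n → Matrix (Fin n) (Fin n) ℝ) (N : E n → ℝ)
    (X : E n → Fin n → ℝ) (R : ℝ) (σ : Metric.sphere (0 : E n) 1) : ℝ :=
  (∑ i, (fluxU G N (ballRadius R • (σ : E n)) i + fluxV G K X (ballRadius R • (σ : E n)) i)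
      * ((xi (ballRadius R • (σ : E n)))⁻¹ * (σ : E n) i))
    * ((xi (ballRadius R • (σ : E n)))⁻¹ ^ (n - 1) * ballRadius R ^ (n - 1))

theorem flux_eq_integral_fluxDensity (N : E n → ℝ) (X : E n → Fin n → ℝ) (R : ℝ) :
    flux G K N X R =
      (2 * ((n : ℝ) - 1) * ((volume : Measure (E n)).toSphere Set.univ).toReal)⁻¹ *
        ∫ σ, fluxDensity G K N X R σ ∂((volume : Measure (E n)).toSphere) := rfl

variable {N N' : E n → ℝ} {X X' : E n → Fin n → ℝ}

theorem RegularEnd.continuousOn_fluxU (h : RegularEnd G K U)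
    (hN : ContDiffOn ℝ 1 N (Metric.ball 0 1)) (i : Fin n) :
    ContinuousOn (fun z => fluxU G N z i) U := by
  have hmetric := fun i j => (h.contDiffOn_metric i j).continuousOn
  have hinv := continuousOn_matrix_inv hmetric h.det_ne_zero
  have hcovD := continuousOn_covD h.isOpen
    (fun i j => (contDiffOn_hypMetric i j).mono h.subset_ball)
    (fun z hz => det_hypMetric_ne_zero (h.subset_ball hz)) h.contDiffOn_metric
  have hlapse := hN.continuousOn.mono h.subset_ball
  have hpartial := fun i => continuousOn_partialD h.isOpen (hN.mono h.subset_ball) i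
  have hxi : ContinuousOn (xi (n := n)) U := (contDiff_xi (m := 0)).continuous.continuousOn
  have hhyp := fun i j =>
    (contDiffOn_hypMetric (n := n) (m := 0) i j).continuousOn.mono h.subset_ball
  unfold fluxU
  exact (hlapse.mul (continuousOn_finsetSum _ fun j _ => continuousOn_finsetSum _ fun k _ =>
    continuousOn_finsetSum _ fun l _ =>
      (((hinv i k).mul (hinv j l)).sub ((hinv i j).mul (hinv k l))).mul (hcovD j k l))).add
    (continuousOn_finsetSum _ fun j _ => continuousOn_finsetSum _ fun k _ =>
      ((((hxi.pow 2).mul (hpartial i)).mul (hinv j k)).sub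
        (((hxi.pow 2).mul (hpartial j)).mul (hinv i k))).mul ((hmetric j k).sub (hhyp j k)))

theorem RegularEnd.continuousOn_fluxV (h : RegularEnd G K U)
    (hX : ∀ i, ContinuousOn (fun z => X z i) (Metric.ball 0 1)) (i : Fin n) :
    ContinuousOn (fun z => fluxV G K X z i) U := by
  have hinv := continuousOn_matrix_inv (fun i j => (h.contDiffOn_metric i j).continuousOn)
    h.det_ne_zero
  have hform := h.continuousOn_form
  unfold fluxV traceK
  exact continuousOn_const.mul (continuousOn_finsetSum _ fun j _ =>
    ((continuousOn_finsetSum _ fun l _ => (hinv i l).mul (hform l j)).sub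
      ((continuousOn_finsetSum _ fun i _ => continuousOn_finsetSum _ fun j _ =>
        (hinv i j).mul (hform i j)).mul continuousOn_const)).mul ((hX j).mono h.subset_ball))

theorem RegularEnd.eventually_integrable_fluxDensity (h : RegularEnd G K U)
    (hNX : RegularLapseShift N X) :
    ∀ᶠ R in atTop, Integrable (fluxDensity G K N X R) (volume : Measure (E n)).toSphere := by
  filter_upwards [h.eventually_sphere_mem] with R hR
  have hmem : ∀ σ : Metric.sphere (0 : E n) 1, ballRadius R • (σ : E n) ∈ U :=
    fun σ => hR σ (mem_sphere_zero_iff_norm.1 σ.2)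
  have hscale : Continuous fun σ : Metric.sphere (0 : E n) 1 => ballRadius R • (σ : E n) := by
    fun_prop
  have hfluxU := fun i =>
    (h.continuousOn_fluxU hNX.contDiffOn_lapse i).comp_continuous hscale hmem
  have hfluxV := fun i =>
    (h.continuousOn_fluxV hNX.continuousOn_shift i).comp_continuous hscale hmem
  have hxi : Continuous fun σ : Metric.sphere (0 : E n) 1 => (xi (ballRadius R • (σ : E n)))⁻¹ :=
    ((contDiff_xi (m := 0)).continuous.comp hscale).inv₀
      fun σ => (xi_pos (h.subset_ball (hmem σ))).ne'
  have hcont : Continuous (fluxDensity G K N X R) :=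
    (continuous_finsetSum _ fun i _ => ((hfluxU i).add (hfluxV i)).mul
      (hxi.mul (by fun_prop))).mul ((hxi.pow _).mul continuous_const)
  exact hcont.integrable_of_hasCompactSupport (HasCompactSupport.of_compactSpace _)

theorem fluxU_add {z : E n} (hN : DifferentiableAt ℝ N z) (hN' : DifferentiableAt ℝ N' z)
    (i : Fin n) : fluxU G (N + N') z i = fluxU G N z i + fluxU G N' z i := by
  have hpartial : ∀ i, partialD i (N + N') z = partialD i N z + partialD i N' z := fun i => by
    simp only [partialD, fderiv_add hN hN', add_apply]
  simp only [fluxU, hpartial, Pi.add_apply, add_mul, mul_add, sub_mul, add_sub_add_comm,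
    Finset.sum_add_distrib]
  ring

theorem fluxU_smul (a : ℝ) (N : E n → ℝ) (z : E n) (i : Fin n) :
    fluxU G (a • N) z i = a * fluxU G N z i := by
  have hpartial : ∀ i, partialD i (a • N) z = a * partialD i N z := fun i => by
    simp only [partialD, fderiv_const_smul_field, smul_apply, smul_eq_mul,
      Pi.smul_apply]
  simp only [fluxU, hpartial, Pi.smul_apply, smul_eq_mul, mul_add a, Finset.mul_sum _ _ a]
  exact congrArg₂ (· + ·) (by ring)
    (Finset.sum_congr rfl fun j _ => Finset.sum_congr rfl fun k _ => by ring)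

theorem fluxV_add (X X' : E n → Fin n → ℝ) (z : E n) (i : Fin n) :
    fluxV G K (X + X') z i = fluxV G K X z i + fluxV G K X' z i := by
  simp only [fluxV, Pi.add_apply, mul_add, Finset.sum_add_distrib]

theorem fluxV_smul (a : ℝ) (X : E n → Fin n → ℝ) (z : E n) (i : Fin n) :
    fluxV G K (a • X) z i = a * fluxV G K X z i := by
  simp only [fluxV, Pi.smul_apply, smul_eq_mul, mul_left_comm _ a, ← Finset.mul_sum]

theorem RegularLapseShift.add (h : RegularLapseShift N X) (h' : RegularLapseShift N' X') :
    RegularLapseShift (N + N') (X + X') where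
  contDiffOn_lapse := h.contDiffOn_lapse.add h'.contDiffOn_lapse
  continuousOn_shift i := (h.continuousOn_shift i).add (h'.continuousOn_shift i)

theorem RegularLapseShift.smul (h : RegularLapseShift N X) (a : ℝ) :
    RegularLapseShift (a • N) (a • X) where
  contDiffOn_lapse := h.contDiffOn_lapse.const_smul a
  continuousOn_shift i := (h.continuousOn_shift i).const_smul a

theorem RegularLapseShift.differentiableAt (h : RegularLapseShift N X) {z : E n}
    (hz : z ∈ Metric.ball (0 : E n) 1) : DifferentiableAt ℝ N z :=
  (h.contDiffOn_lapse.differentiableOn one_ne_zero).differentiableAt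
    (Metric.isOpen_ball.mem_nhds hz)

theorem fluxDensity_add (h : RegularLapseShift N X) (h' : RegularLapseShift N' X') (R : ℝ)
    (σ : Metric.sphere (0 : E n) 1) :
    fluxDensity G K (N + N') (X + X') R σ =
      fluxDensity G K N X R σ + fluxDensity G K N' X' R σ := by
  have hz := ballRadius_smul_mem_ball R (mem_sphere_zero_iff_norm.1 σ.2)
  simp only [fluxDensity, fluxU_add (h.differentiableAt hz) (h'.differentiableAt hz), fluxV_add,
    add_mul, Finset.sum_add_distrib]
  ring

theorem fluxDensity_smul (a : ℝ) (N : E n → ℝ) (X : E n → Fin n → ℝ) (R : ℝ)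
    (σ : Metric.sphere (0 : E n) 1) :
    fluxDensity G K (a • N) (a • X) R σ = a * fluxDensity G K N X R σ := by
  simp only [fluxDensity, fluxU_smul, fluxV_smul, ← mul_add, mul_assoc, ← Finset.mul_sum]

theorem HasMass.congr {m : ℝ} (h : HasMass G K N X m) (hN : Set.EqOn N N' (Metric.ball 0 1))
    (hX : Set.EqOn X X' (Metric.ball 0 1)) : HasMass G K N' X' m := by
  refine Filter.Tendsto.congr (fun R => ?_) h
  rw [flux_eq_integral_fluxDensity, flux_eq_integral_fluxDensity]
  refine congrArg _ (integral_congr_ae (ae_of_all _ fun σ => ?_))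
  have hz := ballRadius_smul_mem_ball R (mem_sphere_zero_iff_norm.1 σ.2)
  have hpartial : ∀ i, partialD i N (ballRadius R • (σ : E n)) =
      partialD i N' (ballRadius R • (σ : E n)) := fun i =>
    congrArg (fun L : E n →L[ℝ] ℝ => L (stdVec i))
      (hN.eventuallyEq_of_mem (Metric.isOpen_ball.mem_nhds hz)).fderiv_eq
  simp only [fluxDensity, fluxU, fluxV, hN hz, hX hz, hpartial]

theorem HasMass.smul {m : ℝ} (h : HasMass G K N X m) (a : ℝ) :
    HasMass G K (a • N) (a • X) (a * m) := by
  refine (h.const_mul a).congr fun R => ?_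
  simp only [flux_eq_integral_fluxDensity, fluxDensity_smul, integral_const_mul]
  ring

theorem RegularEnd.hasMass_add (hE : RegularEnd G K U) (hNX : RegularLapseShift N X)
    (hNX' : RegularLapseShift N' X') {m m' : ℝ} (hm : HasMass G K N X m)
    (hm' : HasMass G K N' X' m') : HasMass G K (N + N') (X + X') (m + m') := by
  refine (Filter.Tendsto.add hm hm').congr' ?_
  filter_upwards [hE.eventually_integrable_fluxDensity hNX,
    hE.eventually_integrable_fluxDensity hNX'] with R hint hint'
  simp only [flux_eq_integral_fluxDensity, fluxDensity_add hNX hNX', integral_add hint hint',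
    mul_add]

/-- The graph of the mass functional `ℋ`, as a subspace: the triples `(N, X, m)` with
`ℋ(N, X) = m`, the lapse `N` and the shift `X` being regular. -/
def massGraph (hE : RegularEnd G K U) : Submodule ℝ ((E n → ℝ) × (E n → Fin n → ℝ) × ℝ) where
  carrier := {p | RegularLapseShift p.1 p.2.1 ∧ HasMass G K p.1 p.2.1 p.2.2}
  zero_mem' := by
    have hdensity : ∀ R σ, fluxDensity G K 0 0 R σ = 0 := fun R σ => by
      simpa using fluxDensity_smul (G := G) (K := K) 0 0 0 R σ
    exact ⟨⟨contDiffOn_const, fun _ => continuousOn_const⟩, tendsto_const_nhds.congr fun R => by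
      simp [flux_eq_integral_fluxDensity, hdensity]⟩
  add_mem' hp hp' := ⟨hp.1.add hp'.1, hE.hasMass_add hp.1 hp'.1 hp.2 hp'.2⟩
  smul_mem' a _ hp := ⟨hp.1.smul a, hp.2.smul a⟩

end Ends

section KillingCurrents

namespace IsCliffordPair

variable {F : Type*} [NormedAddCommGroup F] [InnerProductSpace ℝ F]
  {V : Type*} [NormedAddCommGroup V] [InnerProductSpace ℂ V]
  {α β : F →ₗ[ℝ] Module.End ℂ V} {J : Module.End ℂ V} (h : IsCliffordPair α β J)
include h

theorem one_sub_left_mul_self (z : F) :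
    (1 - α z) * (1 - α z) = (1 + ‖z‖ ^ 2) • 1 - (2 : ℝ) • α z := by
  rw [mul_sub, mul_one, sub_mul, one_mul, h.left_mul_self]
  module

theorem one_sub_left_mul_right_mul_one_sub_left (z v : F) :
    (1 - α z) * β v * (1 - α z) = (1 + ‖z‖ ^ 2) • β v - (2 * inner ℝ z v) • β z
      - (α z * β v - α v * β z) := by
  have htriple : α z * (α v * β z) = (2 * inner ℝ z v) • β z - ‖z‖ ^ 2 • β v := by
    rw [← mul_assoc, ← sub_eq_iff_eq_add.mpr (h.left_mul_add_left_mul z v).symm, sub_mul,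
      mul_assoc (α v), h.left_mul_right z z, h.left_mul_self, smul_mul_assoc, one_mul,
      smul_mul_assoc, one_mul, mul_smul_comm, h.left_mul_J]
  rw [sub_mul, one_mul, mul_sub, mul_one, sub_mul, mul_assoc (α z), h.right_mul_left, mul_neg,
    htriple]
  module

end IsCliffordPair

variable {n : ℕ} {S : Type*} [NormedAddCommGroup S] [InnerProductSpace ℂ S]
  (c : SpinorModule n S)

theorem expectation_killingSpinor (u : DoubleSpinor S) {z : E n}
    (hz : z ∈ Metric.ball (0 : E n) 1) (T : Module.End ℂ (DoubleSpinor S)) :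
    expectation (killingSpinor c u z) T =
      (xi z)⁻¹ * expectation u ((1 - opY c z) * T * (1 - opY c z)) := by
  have hsymm : (1 - opY c z).IsSymmetric :=
    LinearMap.IsSymmetric.one.sub ((isCliffordPair_opY_opX c).isSymmetric_left z)
  have hxi : xi z ^ (-(1 / 2) : ℝ) * xi z ^ (-(1 / 2) : ℝ) = (xi z)⁻¹ := by
    rw [← Real.rpow_add (xi_pos hz), ← Real.rpow_neg_one]
    norm_num
  rw [killingSpinor_eq_opY, ← expectation_apply_symmetric hsymm, ← hxi]
  simp only [expectation_apply, map_smul, inner_smul_left, inner_smul_right, Complex.conj_ofReal,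
    Complex.re_ofReal_mul, mul_assoc]

theorem currentN_killingSpinor (u : DoubleSpinor S) {z : E n}
    (hz : z ∈ Metric.ball (0 : E n) 1) :
    currentN (killingSpinor c u z) =
      2 / (1 - ‖z‖ ^ 2) * ((1 + ‖z‖ ^ 2) * ‖u‖ ^ 2 - 2 * inner ℝ z (currentY c u)) := by
  rw [currentN, ← expectation_one, expectation_killingSpinor c u hz, mul_one,
    (isCliffordPair_opY_opX c).one_sub_left_mul_self, map_sub, map_smul, map_smul, expectation_one,
    ← inner_currentY, xi, inv_div, smul_eq_mul, smul_eq_mul]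

/-- The current of a spinor that is paired with the angular momentum. Only its antisymmetric part
matters. -/
noncomputable def currentA (ψ : DoubleSpinor S) : Matrix (Fin n) (Fin n) ℝ := fun k l =>
  expectation ψ (opY c (stdVec k) * opX c (stdVec l))

theorem sum_sum_smul_mul {R : Type*} [Ring R] [Algebra ℝ R] (α β : E n →ₗ[ℝ] R) (v w : E n) :
    ∑ k, ∑ l, (v k * w l) • (α (stdVec k) * β (stdVec l)) = α v * β w := by
  conv_rhs => rw [← sum_smul_stdVec v, ← sum_smul_stdVec w]
  simp only [map_sum, map_smul, Finset.sum_mul_sum, smul_mul_smul_comm]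

theorem sum_sum_wedge_smul_mul {R : Type*} [Ring R] [Algebra ℝ R] (α β : E n →ₗ[ℝ] R) (v w : E n) :
    ∑ k, ∑ l, (v k * w l - v l * w k) • (α (stdVec k) * β (stdVec l)) =
      α v * β w - α w * β v := by
  simp only [sub_smul, Finset.sum_sub_distrib, mul_comm (v _) (w _)]
  rw [← sum_sum_smul_mul α β v w, ← sum_sum_smul_mul α β w v]
  simp only [mul_comm (v _) (w _)]

theorem IsCliffordPair.sum_sum_smul_left_mul_right {V : Type*} [NormedAddCommGroup V]
    [InnerProductSpace ℂ V] {α β : E n →ₗ[ℝ] Module.End ℂ V} {J : Module.End ℂ V}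
    (h : IsCliffordPair α β J) {A : Matrix (Fin n) (Fin n) ℝ} {a : ℝ} {e f : E n}
    (hef : inner ℝ e f = (0 : ℝ)) (hA : ∀ i j, A i j = a * (e i * f j - e j * f i)) :
    ∑ k, ∑ l, A k l • (α (stdVec k) * β (stdVec l)) = (2 * a) • (α e * β f) := by
  simp only [hA, mul_smul, ← Finset.smul_sum]
  rw [sum_sum_wedge_smul_mul, h.left_mul_right_of_inner_eq_zero hef]
  module

theorem IsCliffordPair.hasMinimizingPair_sub_sum_sum {V : Type*} [NormedAddCommGroup V]
    [InnerProductSpace ℂ V] {α β : E n →ₗ[ℝ] Module.End ℂ V} {J : Module.End ℂ V}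
    (h : IsCliffordPair α β J) (hn : 2 ≤ n) {P C : E n} {A : Matrix (Fin n) (Fin n) ℝ}
    (hcase : A = 0 ∨ (IsSimple A ∧ C = 0) ∨ (IsSimple A ∧ P = 0)) :
    HasMinimizingPair α β
      (α P + β C - ∑ k, ∑ l, A k l • (α (stdVec k) * β (stdVec l))) := by
  have hE : 2 ≤ Module.finrank ℝ (E n) := by rwa [finrank_euclideanSpace_fin]
  rcases hcase with rfl | ⟨⟨a, e, f, he, hf, hef, hA⟩, rfl⟩ | ⟨⟨a, e, f, he, hf, hef, hA⟩, rfl⟩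
  · simpa only [Matrix.zero_apply, zero_smul, Finset.sum_const_zero, sub_zero] using
      h.hasMinimizingPair_add hE P C
  · rw [h.sum_sum_smul_left_mul_right hef hA, map_zero, add_zero, sub_eq_add_neg, ← neg_smul]
    exact h.hasMinimizingPair_left_add_smul hE ⟨he, hf, hef⟩ P _
  · rw [h.sum_sum_smul_left_mul_right hef hA, map_zero, zero_add, sub_eq_add_neg, ← neg_smul]
    exact h.hasMinimizingPair_right_add_smul hE ⟨he, hf, hef⟩ C _

theorem expectation_opY_mul_opX (ψ : DoubleSpinor S) (v w : E n) :
    expectation ψ (opY c v * opX c w) = ∑ k, ∑ l, v k * w l * currentA c ψ k l := by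
  rw [← sum_sum_smul_mul]
  simp only [map_sum, map_smul, smul_eq_mul, currentA]

theorem xi_mul_currentX_killingSpinor (u : DoubleSpinor S) {z : E n}
    (hz : z ∈ Metric.ball (0 : E n) 1) (j : Fin n) :
    xi z * currentX c (killingSpinor c u z) j =
      (1 + ‖z‖ ^ 2) * currentX c u j - 2 * z j * inner ℝ z (currentX c u)
        - ∑ k, z k * (currentA c u k j - currentA c u j k) := by
  have hinner : inner ℝ z (stdVec j) = z j := by
    rw [stdVec, EuclideanSpace.inner_single_right]
    simp
  have hfirst : expectation u (opY c z * opX c (stdVec j)) = ∑ k, z k * currentA c u k j := by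
    simp [expectation_opY_mul_opX, stdVec]
  have hsecond : expectation u (opY c (stdVec j) * opX c z) = ∑ k, z k * currentA c u j k := by
    simp [expectation_opY_mul_opX, stdVec]
  change xi z * expectation (killingSpinor c u z) (opX c (stdVec j)) =
    (1 + ‖z‖ ^ 2) * expectation u (opX c (stdVec j)) - _ - _
  rw [expectation_killingSpinor c u hz, mul_inv_cancel_left₀ (xi_pos hz).ne',
    (isCliffordPair_opY_opX c).one_sub_left_mul_right_mul_one_sub_left, hinner, inner_currentX]
  simp only [map_sub, map_smul, smul_eq_mul, hfirst, hsecond, mul_sub, Finset.sum_sub_distrib]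

/-- The operator whose expectation in the state `u` is the mass of the imaginary Killing spinor
of `u`. -/
noncomputable def massOp (energy : ℝ) (linMom center : E n) (angMom : Matrix (Fin n) (Fin n) ℝ) :
    Module.End ℂ (DoubleSpinor S) :=
  energy • 1 + (opY c linMom + opX c center
    - ∑ k, ∑ l, angMom k l • (opY c (stdVec k) * opX c (stdVec l)))

theorem expectation_massOp (u : DoubleSpinor S) (energy : ℝ) (linMom center : E n)
    (angMom : Matrix (Fin n) (Fin n) ℝ) :
    expectation u (massOp c energy linMom center angMom) =
      ‖u‖ ^ 2 * energy + ∑ i, currentY c u i * linMom i + ∑ i, currentX c u i * center i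
        - ∑ k, ∑ l, currentA c u k l * angMom k l := by
  simp only [massOp, map_add, map_sub, map_sum, map_smul, smul_eq_mul, expectation_one,
    ← inner_currentX, ← inner_currentY, PiLp.inner_apply, currentA, RCLike.inner_apply,
    conj_trivial, mul_comm energy, mul_comm (angMom _ _)]
  ring

variable {G K : E n → Matrix (Fin n) (Fin n) ℝ} {U : Set (E n)} {energy : ℝ}
  {linMom center : E n} {angMom : Matrix (Fin n) (Fin n) ℝ}

theorem contDiffOn_two_div_one_sub_norm_sq :
    ContDiffOn ℝ 1 (fun z : E n => 2 / (1 - ‖z‖ ^ 2)) (Metric.ball 0 1) :=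
  (contDiff_xi.contDiffOn.inv fun _ hz => (xi_pos hz).ne').congr fun z _ => by
    rw [Pi.inv_apply, xi, inv_div]

theorem RegularLapseShift.of_lapse {N : E n → ℝ} (hN : ContDiffOn ℝ 1 N (Metric.ball 0 1)) :
    RegularLapseShift N fun _ _ => 0 :=
  ⟨hN, fun _ => continuousOn_const⟩

theorem RegularLapseShift.of_shift {X : E n → Fin n → ℝ}
    (hX : ∀ i, Continuous fun z => X z i) : RegularLapseShift (fun _ => 0) X :=
  ⟨contDiffOn_const, fun i => (hX i).continuousOn⟩

theorem HasCharges.lapse_mem_massGraph (h : HasCharges G K energy linMom center angMom)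
    (hE : RegularEnd G K U) (t : ℝ) (y : E n) :
    (fun z : E n => 2 / (1 - ‖z‖ ^ 2) * ((1 + ‖z‖ ^ 2) * t - 2 * inner ℝ z y), fun _ _ => 0,
      t * energy + ∑ i, y i * linMom i) ∈ massGraph hE := by
  have henergy : (_, _, energy) ∈ massGraph hE := ⟨.of_lapse
    (contDiffOn_two_div_one_sub_norm_sq.mul
      (contDiff_const.add (contDiff_norm_sq ℝ)).contDiffOn), h.hasEnergy⟩
  have hlinMom (i : Fin n) : (fun z : E n => -2 * (2 / (1 - ‖z‖ ^ 2) * z i), fun _ _ => 0,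
      linMom i) ∈ massGraph hE := ⟨.of_lapse
    (contDiffOn_const.mul (contDiffOn_two_div_one_sub_norm_sq.mul
      (EuclideanSpace.proj (𝕜 := ℝ) i).contDiff.contDiffOn)), h.hasLinMom i⟩
  convert add_mem ((massGraph hE).smul_mem t henergy)
    (sum_mem fun i (_ : i ∈ Finset.univ) => (massGraph hE).smul_mem (y i) (hlinMom i)) using 1
  refine Prod.ext (funext fun z => ?_) (Prod.ext (funext₂ fun z j => ?_) ?_)
  · simp only [Prod.fst_add, Prod.fst_sum, Prod.smul_fst, Pi.add_apply, Pi.smul_apply,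
      Finset.sum_apply, smul_eq_mul, PiLp.inner_apply, RCLike.inner_apply, conj_trivial, mul_sub,
      Finset.mul_sum]
    rw [sub_eq_add_neg, ← Finset.sum_neg_distrib]
    exact congrArg₂ (· + ·) (by ring) (Finset.sum_congr rfl fun i _ => by ring)
  · simp [Prod.fst_sum, Prod.snd_sum]
  · simp [Prod.snd_sum]

theorem HasCharges.conformal_mem_massGraph (h : HasCharges G K energy linMom center angMom)
    (hE : RegularEnd G K U) (x : E n) :
    (fun _ : E n => 0, fun z j => (1 + ‖z‖ ^ 2) * x j - 2 * z j * inner ℝ z x,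
      ∑ i, x i * center i) ∈ massGraph hE := by
  have hcenter (i : Fin n) : (_, _, center i) ∈ massGraph hE :=
    ⟨.of_shift fun k => by fun_prop, h.hasCenter i⟩
  convert sum_mem fun i (_ : i ∈ Finset.univ) => (massGraph hE).smul_mem (x i) (hcenter i) using 1
  refine Prod.ext (funext fun z => ?_) (Prod.ext (funext₂ fun z j => ?_) ?_)
  · simp [Prod.fst_sum]
  · simp only [Prod.snd_sum, Prod.fst_sum, Finset.sum_apply, Prod.smul_mk, Pi.smul_apply,
      smul_eq_mul, PiLp.inner_apply, RCLike.inner_apply, Real.ringHom_apply, Finset.mul_sum,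
      mul_sub, mul_ite, mul_one, mul_zero, Finset.sum_sub_distrib, Finset.sum_ite_eq,
      Finset.mem_univ, if_true]
    exact congrArg₂ (· - ·) (by ring) (Finset.sum_congr rfl fun i _ => by ring)
  · simp [Prod.snd_sum]

theorem HasCharges.rotation_mem_massGraph (h : HasCharges G K energy linMom center angMom)
    (hE : RegularEnd G K U) (A : Matrix (Fin n) (Fin n) ℝ) :
    (fun _ : E n => 0, fun z j => ∑ k, z k * (A k j - A j k),
      ∑ k, ∑ l, A k l * angMom k l) ∈ massGraph hE := by
  have hangMom (k l : Fin n) : (_, _, angMom k l) ∈ massGraph hE :=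
    ⟨.of_shift fun k => by fun_prop, h.hasAngMom k l⟩
  convert sum_mem fun k (_ : k ∈ Finset.univ) => sum_mem fun l (_ : l ∈ Finset.univ) =>
    (massGraph hE).smul_mem (A k l) (hangMom k l) using 1
  refine Prod.ext (funext fun z => ?_) (Prod.ext (funext₂ fun z j => ?_) ?_)
  · simp [Prod.fst_sum]
  · simp [Prod.fst_sum, Prod.snd_sum, mul_sub, sub_mul, mul_comm (z _)]
  · simp [Prod.snd_sum]

theorem HasCharges.hasSpinorMass (h : HasCharges G K energy linMom center angMom)
    (hE : RegularEnd G K U) (u : DoubleSpinor S) :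
    HasSpinorMass c G K u (expectation u (massOp c energy linMom center angMom)) := by
  have hmass := (sub_mem (add_mem (h.lapse_mem_massGraph hE (‖u‖ ^ 2) (currentY c u))
    (h.conformal_mem_massGraph hE (currentX c u)))
    (h.rotation_mem_massGraph hE (currentA c u))).2
  rw [HasSpinorMass, expectation_massOp]
  refine hmass.congr (fun z hz => ?_) (fun z hz => funext fun j => ?_)
  · simp [currentN_killingSpinor c u hz]
  · simp [xi_mul_currentX_killingSpinor c u hz]

theorem hasMinimizingPair_massOp (hn : 2 ≤ n)
    (hcase : angMom = 0 ∨ (IsSimple angMom ∧ center = 0) ∨ (IsSimple angMom ∧ linMom = 0)) :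
    HasMinimizingPair (opY c) (opX c) (massOp c energy linMom center angMom) :=
  ((isCliffordPair_opY_opX c).hasMinimizingPair_sub_sum_sum hn hcase).smul_one_add energy

end KillingCurrents

end AdS

open AdS in
theorem mainTheorem11_general {n : ℕ} (hn : 2 ≤ n) {G K : E n → Matrix (Fin n) (Fin n) ℝ}
    {U : Set (E n)} (hE : RegularEnd G K U)
    {S : Type*} [NormedAddCommGroup S] [InnerProductSpace ℂ S] (c : SpinorModule n S)
    {energy : ℝ} {linMom center : E n} {angMom : Matrix (Fin n) (Fin n) ℝ}
    (hcharges : HasCharges G K energy linMom center angMom)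
    (hcase : angMom = 0 ∨ (IsSimple angMom ∧ center = 0) ∨ (IsSimple angMom ∧ linMom = 0)) :
    ∃ u : DoubleSpinor S, u ≠ 0 ∧ IsImaginaryKilling c (killingSpinor c u) ∧
      (∀ z : E n, ‖z‖ < 1 → IsNull c (killingSpinor c u z) ∧ IsTypeI c (killingSpinor c u z)) ∧
      IsMassMinimizing c G K u := by
  obtain ⟨y, x, hyx, hmin⟩ := hasMinimizingPair_massOp c (energy := energy) hn hcase
  obtain ⟨u, hu, hyu, hxu⟩ := exists_ne_zero_opY_opX_fixed c hyx
  refine ⟨u, hu, isImaginaryKilling_killingSpinor c u, fun z _ =>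
    ⟨isNull_killingSpinor c hyx.norm_right hyu hxu z, isTypeI_killingSpinor c hyx.norm_left hyu z⟩,
    _, hcharges.hasSpinorMass c hE u, fun v hv => ⟨_, hcharges.hasSpinorMass c hE v, ?_⟩⟩
  exact hmin u hyu hxu (mem_sphere_zero_iff_norm.mpr hv)

theorem mainTheorem11 (n s : ℕ) (hn : 2 ≤ n) (hs : 2 ≤ s) (a q : ℝ)
    (ha : 0 < a ∧ a < 1) (hq : (n : ℝ) / 2 < q ∧ q ≤ n)
    (M : Type*) [MetricSpace M] [ChartedSpace (AdS.E n) M] [IsManifold 𝓘(ℝ, AdS.E n) ∞ M]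
    [Bundle.RiemannianBundle (fun x : M => TangentSpace 𝓘(ℝ, AdS.E n) x)]
    [IsContMDiffRiemannianBundle 𝓘(ℝ, AdS.E n) 2 (AdS.E n)
      (fun x : M => TangentSpace 𝓘(ℝ, AdS.E n) x)]
    [IsRiemannianManifold 𝓘(ℝ, AdS.E n) M] [CompleteSpace M] [ConnectedSpace M]
    (D : AdS.AsymptoticallyAdS n s a q M) (l : Fin D.numEnds)
    (S : Type*) [NormedAddCommGroup S] [InnerProductSpace ℂ S] (c : AdS.SpinorModule n S)
    (energy : ℝ) (linMom center : AdS.E n) (angMom : Matrix (Fin n) (Fin n) ℝ)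
    (hcharges : AdS.HasCharges (D.gEnd l) (D.kEnd l) energy linMom center angMom)
    (hcase : angMom = 0 ∨ (AdS.IsSimple angMom ∧ center = 0) ∨
      (AdS.IsSimple angMom ∧ linMom = 0)) :
    ∃ u : AdS.DoubleSpinor S, u ≠ 0 ∧
      AdS.IsImaginaryKilling c (AdS.killingSpinor c u) ∧
      (∀ z : AdS.E n, ‖z‖ < 1 →
        AdS.IsNull c (AdS.killingSpinor c u z) ∧ AdS.IsTypeI c (AdS.killingSpinor c u z)) ∧
      AdS.IsMassMinimizing c (D.gEnd l) (D.kEnd l) u :=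
  mainTheorem11_general hn
    (AdS.regularEnd_of_inWeightedHolder (by lia) (by linarith [n.cast_nonneg (α := ℝ)])
      (D.metric_decay l) fun i j => (D.k_decay l i j).1.continuousOn) c hcharges hcase
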